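/- **Setting.** Let $\mathcal S,\mathcal A$ be finite, let $P^a(s,\cdot)$ be transition probabilities, $p_0$ an initial distribution on $\mathcal S$, $\gamma\in(0,1)$, and $f:\Delta(\mathcal S\times\mathcal A)\to\mathbb R$ an objective that is $L$-Lipschitz for the $\ell_1$-norm, $L>0$, with $f_{\min}\le f(d)\le f_{\max}$ for all $d\in\Delta(\mathcal S\times\mathcal A)$, where $f_{\min}<f_{\max}$. For a non-Markovian (history-dependent, randomized) policy $\pi$ let $\mathbf d^\pi(s,a)=(1-\gamma)\sum_{t\ge0}\gamma^t\mathbf 1(s_t=s,a_t=a)$ be the empirical discounted occupancy of its random trajectory, $F_1^{f}(\pi)=\mathbb E[f(\mathbf d^\pi)]$, and $\mathcal R^{f}(\pi)=F_1^{f}(\pi)-\inf_{\pi'}F_1^{f}(\pi')$, the infimum being over all non-Markovian policies. Let $\tilde f=(f-f_{\min})/(f_{\max}-f_{\min})$. For a horizon $H\ge1$, the occupancy MDP has states $\{s,o\}$, where $o\in\mathbb R^{\mathcal S\times\mathcal A}$ is the running occupancy $o(s,a)=\sum_{i<t}\gamma^i\mathbf 1(s_i=s,a_i=a)$ (the timestep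 $t$ is determined by the sum of the entries of $o$), initial state $\{s_0,0\}$ with $s_0\sim p_0$, transitions $s_{t+1}\sim P^{a_t}(s_t,\cdot)$, $o_{t+1}=o_t+\gamma^t\mathbf e_{(s_t,a_t)}$, and cost $0$ at times $t<H$ and $f\big(\tfrac{1-\gamma}{1-\gamma^H}o\big)$ at time $H$. Let $J_O(\pi_O)$ be the expected cumulative cost of a stationary policy $\pi_O$, and let $J_O^*$ and $Q^*$ be the optimal cumulative cost and the optimal action-value function (infima over stationary deterministic policies). **Algorithm.** At a state $x=\{s,o\}$ at time $t<H$, MCTS (UCT) with $n$ iterations grows a search tree rooted at $x$, of depth $H-t$, for the occupancy MDP with objective $\tilde f$. At each visited node an iteration plays an untried action if there is one, and evaluates the sampled successor by a trajectory of a fixed rollout policy up to time $H$; otherwise it plays an action $a$ that minimizes $\overline X_a-2C_p\sqrt{\ln N/N_a}$ (where $\overline X_a$ is the average return of $a$ at the node, $N_a$ its visit count and $N=\sum_aN_a$), samples the successor state and descends to the corresponding child. The return is then added to the statistics of all actions played at nodes of the tree. After $n$ iterations an action with least average return at the root is played. The constant $C_p>0$, the rollout policy and the (possibly randomized) choices among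 untried or tied actions are arbitrary. Let $\pi_{O,n}$ be the induced stationary policy of the occupancy MDP, a fresh search being run at each timestep, and let $\pi_{\mathrm{MCTS},n}$ be the corresponding non-Markovian policy, which plays $\pi_{O,n}$ at times $t<H$ and is arbitrary at times $t\ge H$. **Statement.** For every $H\ge1$: 1. At every state $x=\{s,o\}$, where $s\in\mathcal S$ and $o$ is the running occupancy of a history of length less than $H$, the probability that the action played by $\pi_{O,n}$ at $x$ minimizes $Q^*(x,\cdot)$ tends to $1$ as $n\to\infty$; and $J_O(\pi_{O,n})\to J_O^*$ as $n\to\infty$. 2. For all sufficiently large $n$, whatever $\pi_{\mathrm{MCTS},n}$ does from time $H$ on, $$\mathcal R^{\tilde f}(\pi_{\mathrm{MCTS},n})\le 8\,\frac{L}{f_{\max}-f_{\min}}\,\gamma^H,\qquad\text{equivalently}\qquad \mathcal R^{f}(\pi_{\mathrm{MCTS},n})\le 8L\gamma^H .$$ -/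

import Mathlib

open MeasureTheory ProbabilityTheory Filter Topology

namespace GUMDP

noncomputable section

/-- Expectation of a real function under a probability mass function. In all uses below the
distribution has finite support, so the series is a finite sum. -/
def expect {X : Type*} (p : PMF X) (g : X → ℝ) : ℝ := ∑' x, (p x).toReal * g x

/-! ### Finite-horizon MDPs with costs on states -/

/-- A finite-horizon MDP: initial distribution, transition probabilities, state cost, horizon. -/
structure MDP (X A : Type*) where
  init : PMF X
  step : X → A → PMF X
  cost : X → ℝ
  horizon : ℕ

namespace MDP

variable {X A : Type*} (M : MDP X A)

/-- Law of the state reached after `k` steps from `x` under the stationary policy `π`. -/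
def lawFrom (π : X → PMF A) (x : X) : ℕ → PMF X
  | 0 => PMF.pure x
  | k + 1 => (lawFrom π x k).bind fun y => (π y).bind fun a => M.step y a

/-- Expected cumulative cost from `x`, with `k` steps to go, under `π`. -/
def value (π : X → PMF A) (k : ℕ) (x : X) : ℝ :=
  ∑ j ∈ Finset.range (k + 1), expect (M.lawFrom π x j) M.cost

/-- Expected cumulative cost when `a` is played at `x`, `k` steps remain after that, and `π` is
followed from then on. -/
def qValue (π : X → PMF A) (k : ℕ) (x : X) (a : A) : ℝ :=
  M.cost x + expect (M.step x a) (M.value π k)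

/-- Optimal action value: infimum over stationary deterministic policies. -/
def optQ (k : ℕ) (x : X) (a : A) : ℝ :=
  ⨅ δ : X → A, M.qValue (fun y => PMF.pure (δ y)) k x a

/-- Expected cumulative cost of `π` over the horizon. -/
def J (π : X → PMF A) : ℝ := expect M.init (M.value π M.horizon)

/-- Optimal cumulative cost: infimum over stationary deterministic policies. -/
def optJ : ℝ := ⨅ δ : X → A, M.J (fun y => PMF.pure (δ y))

end MDP

/-! ### Monte-Carlo tree search with upper confidence bounds (UCT) -/

/-- Free parameters of the search: the exploration constant, the (possibly randomized) rule that
picks an element of a nonempty set of candidate actions, and the rollout policy. -/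
structure UCTParams (X A : Type*) where
  Cp : ℝ
  Cp_pos : 0 < Cp
  pick : Finset A → PMF A
  pick_mem : ∀ B : Finset A, B.Nonempty → ∀ a ∈ (pick B).support, a ∈ B
  rollout : X → PMF A

/-- Statistics of the search tree. A decision node is the list of simulated (action, next state)
pairs that lead from the root to it, most recent first; for each node and action we store the visit
count and the sum of the returns. Edges with count `0` are not (yet) in the tree. -/
abbrev Tree (X A : Type*) := List (A × X) → A → ℕ × ℝ

namespace Tree

variable {X A : Type*} [Fintype A] (T : Tree X A)

/-- Average return of action `a` at node `p`. -/
def mean (p : List (A × X)) (a : A) : ℝ := (T p a).2 / ((T p a).1 : ℝ)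

/-- Total number of visits of node `p`. -/
def visits (p : List (A × X)) : ℕ := ∑ a, (T p a).1

/-- UCB1 index of an action, in the form for costs (a lower confidence bound). -/
def index (Cp : ℝ) (p : List (A × X)) (a : A) : ℝ :=
  T.mean p a - 2 * Cp * Real.sqrt (Real.log (T.visits p : ℝ) / ((T p a).1 : ℝ))

open scoped Classical in
/-- Actions never tried at node `p`. -/
def untried (p : List (A × X)) : Finset A := {a | (T p a).1 = 0}

open scoped Classical in
/-- Actions of optimal confidence index at node `p`. -/
def greedy (Cp : ℝ) (p : List (A × X)) : Finset A :=
  {a | ∀ b, T.index Cp p a ≤ T.index Cp p b}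

open scoped Classical in
/-- Tried actions of least average cost at node `p`. -/
def best (p : List (A × X)) : Finset A :=
  {a | (T p a).1 ≠ 0 ∧ ∀ b, (T p b).1 ≠ 0 → T.mean p a ≤ T.mean p b}

open scoped Classical in
/-- Backpropagation of the return `g` to action `a` of node `p`. -/
def record (p : List (A × X)) (a : A) (g : ℝ) : Tree X A := fun q b =>
  if q = p ∧ b = a then ((T q b).1 + 1, (T q b).2 + g) else T q b

open scoped Classical in
/-- Action chosen at node `p` during an iteration: an untried action if there is one (expansion),
else an action of optimal confidence index (selection). -/
def choose (θ : UCTParams X A) (p : List (A × X)) : PMF A :=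
  if (T.untried p).Nonempty then θ.pick (T.untried p) else θ.pick (T.greedy θ.Cp p)

end Tree

section UCT

variable {X A : Type*} [Fintype A] (M : MDP X A) (θ : UCTParams X A)

/-- Simulation phase: return of a trajectory of `k` steps from `x` under the rollout policy. -/
def rolloutReturn : ℕ → X → PMF ℝ
  | 0, x => PMF.pure (M.cost x)
  | k + 1, x => (θ.rollout x).bind fun a => (M.step x a).bind fun y =>
      (rolloutReturn k y).map fun g => M.cost x + g

/-- One iteration from node `p` at state `x` with `k` steps to go: the return together with the
updated statistics. If the chosen action was untried, the successor is evaluated by a rollout,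
otherwise the search descends to it; on the way back the return is recorded. -/
def iteration (T : Tree X A) : ℕ → List (A × X) → X → PMF (ℝ × Tree X A)
  | 0, _, x => PMF.pure (M.cost x, T)
  | k + 1, p, x => (T.choose θ p).bind fun a => (M.step x a).bind fun y =>
      (if (T p a).1 = 0 then (rolloutReturn M θ k y).map fun g => (g, T)
        else iteration T k ((a, y) :: p) y).map fun r =>
          (M.cost x + r.1, r.2.record p a (M.cost x + r.1))

/-- Law of the search tree after `n` iterations from root state `x` with `k` steps to go. -/
def search (k : ℕ) (x : X) : ℕ → PMF (Tree X A)
  | 0 => PMF.pure fun _ _ => (0, 0)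
  | n + 1 => (search k x n).bind fun T => (iteration M θ T k [] x).map Prod.snd

/-- Law of the action returned after `n` iterations: least average cost at the root. -/
def uctAction (k n : ℕ) (x : X) : PMF A :=
  (search M θ k x n).bind fun T => θ.pick (T.best [])

end UCT

/-! ### General-utility MDPs and the single-trial objective -/

/-- Transition probabilities and initial distribution of a GUMDP. -/
structure Env (S A : Type*) where
  P : A → S → PMF S
  p₀ : PMF S

/-- A non-Markovian policy: at each time `t`, a distribution over actions given
the past pairs `(s₀,a₀),…,(s_{t-1},a_{t-1})` and the current state. -/
abbrev Policy (S A : Type*) := (t : ℕ) → (Fin t → S × A) → S → PMF A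

section Trajectory

variable {S A : Type*} [Finite S] [Finite A]
  [MeasurableSpace S] [DiscreteMeasurableSpace S] [MeasurableSpace A] [DiscreteMeasurableSpace A]

/-- Law of the next state-action pair given the pairs up to time `n`. -/
def nextKernel (E : Env S A) (π : Policy S A) (n : ℕ) :
    Kernel ((i : Finset.Iic n) → (fun _ : ℕ => S × A) i) (S × A) :=
  Kernel.ofFunOfCountable fun h =>
    let past : Fin (n + 1) → S × A := fun i => h ⟨i, Finset.mem_Iic.2 (Nat.lt_succ_iff.1 i.2)⟩
    ((E.P (past (Fin.last n)).2 (past (Fin.last n)).1).bind fun s =>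
      (π (n + 1) past s).map fun a => (s, a)).toMeasure

instance (E : Env S A) (π : Policy S A) (n : ℕ) : IsMarkovKernel (nextKernel E π n) :=
  ⟨fun _ => PMF.toMeasure.isProbabilityMeasure _⟩

/-- Law of the trajectory `(s₀,a₀),(s₁,a₁),…` under policy `π`. -/
def trajLaw (E : Env S A) (π : Policy S A) : Measure (ℕ → S × A) :=
  Kernel.trajMeasure (X := fun _ => S × A)
    (E.p₀.bind fun s => (π 0 Fin.elim0 s).map fun a => (s, a)).toMeasure (nextKernel E π)

open scoped Classical in
/-- Discounted empirical state-action occupancy of a trajectory. -/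
def empOcc (γ : ℝ) (ω : ℕ → S × A) (z : S × A) : ℝ :=
  (1 - γ) * ∑' t : ℕ, γ ^ t * (if ω t = z then 1 else 0)

/-- The single-trial objective. -/
def F₁ (E : Env S A) (γ : ℝ) (f : (S × A → ℝ) → ℝ) (π : Policy S A) : ℝ :=
  ∫ ω, f (empOcc γ ω) ∂(trajLaw E π)

/-- Regret for the single-trial objective. -/
def regret (E : Env S A) (γ : ℝ) (f : (S × A → ℝ) → ℝ) (π : Policy S A) : ℝ :=
  F₁ E γ f π - ⨅ π' : Policy S A, F₁ E γ f π'

end Trajectory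

/-! ### The occupancy MDP -/

section Occupancy

variable {S A : Type*}

/-- A state of the occupancy MDP: a state together with a running occupancy. -/
abbrev OState (S A : Type*) := S × (S × A → ℝ)

open scoped Classical in
/-- Running occupancy of the pairs `(s₀,a₀),…,(s_{l-1},a_{l-1})`. -/
def runOcc (γ : ℝ) {l : ℕ} (h : Fin l → S × A) (z : S × A) : ℝ :=
  ∑ t : Fin l, γ ^ (t : ℕ) * (if h t = z then 1 else 0)

/-- The set of running occupancies of histories of length less than `H`. -/
def occSet (S A : Type*) (γ : ℝ) (H : ℕ) : Set (S × A → ℝ) :=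
  {o | ∃ l < H, ∃ h : Fin l → S × A, o = runOcc γ h}

/-- The timestep, inferred from the sum of the entries of the running occupancy. -/
def clock [Fintype S] [Fintype A] (γ : ℝ) (o : S × A → ℝ) : ℕ :=
  sInf {t : ℕ | ∑ z, o z = ∑ i ∈ Finset.range t, γ ^ i}

open scoped Classical in
/-- Deterministic evolution of the running occupancy. -/
def nextOcc [Fintype S] [Fintype A] (γ : ℝ) (x : OState S A) (a : A) : S × A → ℝ := fun z =>
  if z = (x.1, a) then x.2 z + γ ^ clock γ x.2 else x.2 z

/-- The occupancy MDP with horizon `H` of a GUMDP with objective `f`. -/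
def occMDP [Fintype S] [Fintype A] (E : Env S A) (γ : ℝ) (f : (S × A → ℝ) → ℝ) (H : ℕ) :
    MDP (OState S A) A where
  init := E.p₀.map fun s => (s, fun _ => 0)
  step x a := (E.P a x.1).map fun s => (s, nextOcc γ x a)
  cost x := if clock γ x.2 = H then f (((1 - γ) / (1 - γ ^ H)) • x.2) else 0
  horizon := H

/-- Actions that are optimal at state `x` of the occupancy MDP. -/
def optActions [Fintype S] [Fintype A] (E : Env S A) (γ : ℝ) (f : (S × A → ℝ) → ℝ) (H : ℕ)
    (x : OState S A) : Set A :=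
  {a | ∀ b, (occMDP E γ f H).optQ (H - clock γ x.2 - 1) x a
    ≤ (occMDP E γ f H).optQ (H - clock γ x.2 - 1) x b}

/-- The objective rescaled from `[fmin, fmax]` to `[0, 1]`. -/
def rescale (f : (S × A → ℝ) → ℝ) (fmin fmax : ℝ) (d : S × A → ℝ) : ℝ :=
  (f d - fmin) / (fmax - fmin)

/-- The stationary policy of the occupancy MDP that, at every state, runs a fresh tree search with
`n` iterations rooted at this state and plays the returned action. -/
def mctsOcc [Fintype S] [Fintype A] (E : Env S A) (γ : ℝ) (f : (S × A → ℝ) → ℝ) (H : ℕ)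
    (θ : UCTParams (OState S A) A) (n : ℕ) (x : OState S A) : PMF A :=
  uctAction (occMDP E γ f H) θ (H - clock γ x.2) n x

/-- The non-Markovian policy that follows the stationary occupancy-MDP policy `πO` before time
`H` and an arbitrary policy `tail` from time `H` on. -/
def toPolicy (γ : ℝ) (H : ℕ) (πO : OState S A → PMF A) (tail : Policy S A) : Policy S A :=
  fun t h s => if t < H then πO (s, runOcc γ h) else tail t h s

end Occupancy

end

end GUMDP

namespace GUMDP

open scoped ENNReal

/-! ### Markov chains given by probability mass functions -/

section Chain

/-! The search is a Markov chain on trees, and its consistency is proved path by path, without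
rates. Two ingredients carry it.

The first is probabilistic. By Ville's inequality, a nonnegative function that is excessive for the
chain stays almost surely bounded along it (`exists_chain`). This is applied to exp(λZ − λ²B²N),
where Z is a centred sum of sampled transitions at a node and N their number. Taking countably many
λ of both signs gives Z/N → 0 whenever N → ∞, however adaptively the actions are chosen
(`IsSearchRun.ae_tendsto_div`).

The second is deterministic. If the average return of each arm played infinitely often converges,
the logarithmic bonus forces every arm to be played infinitely often, while suboptimal arms are
played only logarithmically often. So the overall average tends to the least of the limits
(`IsIndexRun.tendsto_total`). No independence or stationarity is assumed, so the drifting returns of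
inner nodes are harmless.

Induction on the steps to go combines the two: at nodes visited infinitely often the averages tend
to the values of dynamic programming (`IsSearchRun.ae_tendsto_mean`). The root is visited at every
iteration, so almost surely its best actions are eventually optimal, and the returned action is
optimal with probability tending to 1 (`tendsto_uctAction`).

In the occupancy MDP the time is a function of the state, so one stationary deterministic policy
attains the values of dynamic programming. Only the terminal layer carries a cost, so rescaling f
preserves the optimal actions. The running occupancy is a sufficient statistic: no history-dependent
policy beats `optJ` on the truncated objective (`truncF_ge_optJ`). Truncation with renormalization
moves the occupancy by at most 2γ^H in ℓ¹. Using it once for the policy and once for the infimum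
bounds the regret by 4Lγ^H plus the optimality gap of `J` (`regret_toPolicy_le`); for large n that
gap is below another 4Lγ^H. -/

theorem toMeasure_eq_sum_dirac {Z : Type*} [MeasurableSpace Z] (p : PMF Z) :
    p.toMeasure = Measure.sum fun z => p z • Measure.dirac z := by
  ext s hs
  rw [PMF.toMeasure_apply _ hs, Measure.sum_apply _ hs]
  refine tsum_congr fun z => ?_
  by_cases hz : z ∈ s <;> simp [hs, hz]

theorem lintegral_toMeasure {Z : Type*} [MeasurableSpace Z] [DiscreteMeasurableSpace Z]
    (p : PMF Z) (W : Z → ℝ≥0∞) : ∫⁻ z, W z ∂p.toMeasure = ∑' z, p z * W z := by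
  rw [toMeasure_eq_sum_dirac, lintegral_sum_measure]
  refine tsum_congr fun z => ?_
  rw [lintegral_smul_measure, lintegral_dirac, smul_eq_mul]

theorem ae_toMeasure_mem_support {Z : Type*} [MeasurableSpace Z] [DiscreteMeasurableSpace Z]
    (p : PMF Z) : ∀ᵐ z ∂p.toMeasure, z ∈ p.support := by
  rw [ae_iff, PMF.toMeasure_apply_eq_zero_iff _ (MeasurableSet.of_discrete)]
  exact Set.disjoint_left.2 fun z hz h => h hz

theorem map_eval_zero_trajMeasure {X : ℕ → Type*} [∀ n, MeasurableSpace (X n)]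
    (μ₀ : Measure (X 0)) [IsProbabilityMeasure μ₀]
    (κ : (n : ℕ) → Kernel (Π i : Finset.Iic n, X i) (X (n + 1))) [∀ n, IsMarkovKernel (κ n)] :
    (Kernel.trajMeasure μ₀ κ).map (fun ω => ω 0) = μ₀ := by
  have h : (Kernel.trajMeasure μ₀ κ).map (Preorder.frestrictLe 0)
      = μ₀.map (MeasurableEquiv.piUnique _).symm := by
    rw [Kernel.trajMeasure, Measure.map_comp _ _ (by fun_prop), Kernel.traj_map_frestrictLe,
      Kernel.partialTraj_self, Measure.id_comp]
  have h2 : (fun ω : (n : ℕ) → X n => ω 0)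
      = (fun x : (i : Finset.Iic 0) → X i => x ⟨0, Finset.mem_Iic.2 le_rfl⟩)
        ∘ Preorder.frestrictLe 0 := rfl
  rw [h2, ← Measure.map_map (by fun_prop) (by fun_prop), h]
  ext s hs
  rw [Measure.map_apply (by fun_prop) hs]
  exact Measure.map_apply (MeasurableEquiv.piUnique fun i : Finset.Iic 0 => X i).symm.measurable
    (measurable_pi_apply (⟨0, Finset.mem_Iic.2 le_rfl⟩ : Finset.Iic 0) hs)

/-- Law at time `n` of the Markov chain with kernel `K` started at `z₀`. -/
noncomputable def chainLaw {Z : Type*} (z₀ : Z) (K : Z → PMF Z) : ℕ → PMF Z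
  | 0 => PMF.pure z₀
  | n + 1 => (chainLaw z₀ K n).bind K

variable {Z : Type*} [MeasurableSpace Z] [DiscreteMeasurableSpace Z]

/-- Transition kernels, on histories, of the Markov chain with kernel `K`. -/
noncomputable def chainKernel (K : Z → PMF Z) (n : ℕ) :
    Kernel ((i : Finset.Iic n) → (fun _ : ℕ => Z) i) Z :=
  Kernel.comap ⟨fun z => (K z).toMeasure, Measurable.of_discrete⟩
    (fun h => h ⟨n, Finset.mem_Iic.2 le_rfl⟩) (measurable_pi_apply _)

theorem chainKernel_apply (K : Z → PMF Z) (n : ℕ)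
    (h : (i : Finset.Iic n) → (fun _ : ℕ => Z) i) :
    chainKernel K n h = (K (h ⟨n, Finset.mem_Iic.2 le_rfl⟩)).toMeasure := rfl

instance (K : Z → PMF Z) (n : ℕ) : IsMarkovKernel (chainKernel K n) :=
  ⟨fun h => by rw [chainKernel_apply]; exact PMF.toMeasure.isProbabilityMeasure _⟩

/-- Law of the trajectory of the Markov chain with kernel `K` started at `z₀`. -/
noncomputable def chainMeasure (z₀ : Z) (K : Z → PMF Z) : Measure (ℕ → Z) :=
  Kernel.trajMeasure (X := fun _ => Z) (PMF.pure z₀).toMeasure (chainKernel K)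

instance (z₀ : Z) (K : Z → PMF Z) : IsProbabilityMeasure (chainMeasure z₀ K) := by
  unfold chainMeasure; infer_instance

/-- The Markov property, for a function of the past and the next state. -/
theorem lintegral_chainMeasure_succ (z₀ : Z) (K : Z → PMF Z) (n : ℕ)
    (g : ((i : Finset.Iic n) → (fun _ : ℕ => Z) i) → Z → ℝ≥0∞) (hg : Measurable g.uncurry) :
    ∫⁻ ω, g (Preorder.frestrictLe n ω) (ω (n + 1)) ∂chainMeasure z₀ K
      = ∫⁻ ω, ∑' z, K (ω n) z * g (Preorder.frestrictLe n ω) z ∂chainMeasure z₀ K := by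
  have h := Kernel.map_frestrictLe_trajMeasure_compProd_eq_map_trajMeasure
    (X := fun _ => Z) (μ₀ := (PMF.pure z₀).toMeasure) (κ := chainKernel K) (a := n)
  have h1 : ∫⁻ ω, g (Preorder.frestrictLe n ω) (ω (n + 1)) ∂chainMeasure z₀ K
      = ∫⁻ q, g.uncurry q ∂((chainMeasure z₀ K).map
          (fun x ↦ (Preorder.frestrictLe n x, x (n + 1)))) := by
    rw [lintegral_map hg (by fun_prop)]; rfl
  rw [h1, chainMeasure, ← h, Measure.lintegral_compProd hg, lintegral_map]
  · refine lintegral_congr fun ω => ?_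
    rw [chainKernel_apply, lintegral_toMeasure]; rfl
  · exact hg.lintegral_kernel_prod_right
  · fun_prop

theorem map_chainMeasure (z₀ : Z) (K : Z → PMF Z) (n : ℕ) :
    (chainMeasure z₀ K).map (fun ω => ω n) = (chainLaw z₀ K n).toMeasure := by
  induction n with
  | zero => exact map_eval_zero_trajMeasure (X := fun _ => Z) _ _
  | succ n ih =>
    ext s hs
    have h := lintegral_chainMeasure_succ z₀ K n (fun _ z => s.indicator 1 z)
      ((measurable_one.indicator hs).comp measurable_snd)
    rw [Measure.map_apply (measurable_pi_apply _) hs, chainLaw, PMF.toMeasure_bind_apply _ _ _ hs]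
    have h1 : chainMeasure z₀ K ((fun ω => ω (n + 1)) ⁻¹' s)
        = ∫⁻ ω, s.indicator 1 (ω (n + 1)) ∂chainMeasure z₀ K := by
      rw [← lintegral_indicator_one (measurable_pi_apply (n + 1) hs)]; rfl
    rw [h1, h]
    have h2 : ∫⁻ ω, ∑' z, K (ω n) z * s.indicator 1 z ∂chainMeasure z₀ K
        = ∫⁻ z, (K z).toMeasure s ∂((chainMeasure z₀ K).map (fun ω => ω n)) := by
      rw [lintegral_map Measurable.of_discrete (measurable_pi_apply _)]
      refine lintegral_congr fun ω => ?_
      rw [← lintegral_toMeasure, lintegral_indicator_one hs]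
    rw [h2, ih, lintegral_toMeasure]

theorem ae_chainMeasure_mem_support_chainLaw (z₀ : Z) (K : Z → PMF Z) (n : ℕ) :
    ∀ᵐ ω ∂chainMeasure z₀ K, ω n ∈ (chainLaw z₀ K n).support := by
  have h := ae_toMeasure_mem_support (chainLaw z₀ K n)
  rw [← map_chainMeasure] at h
  exact ae_of_ae_map (measurable_pi_apply n).aemeasurable h

theorem ae_chainMeasure_support (z₀ : Z) (K : Z → PMF Z) :
    ∀ᵐ ω ∂chainMeasure z₀ K, ∀ n, ω (n + 1) ∈ (K (ω n)).support := by
  refine ae_all_iff.2 fun n => ?_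
  -- The state space may be uncountable. Null sets are therefore collected only over the support of
  -- the law at time n, which is countable and contains ω n almost surely.
  have h : ∀ z ∈ (chainLaw z₀ K n).support,
      ∀ᵐ ω ∂chainMeasure z₀ K, ω n = z → ω (n + 1) ∈ (K z).support := by
    intro z _
    have hB : MeasurableSet ({z} : Set Z) := MeasurableSet.of_discrete
    have hB' : MeasurableSet ((K z).supportᶜ : Set Z) := MeasurableSet.of_discrete
    have h := lintegral_chainMeasure_succ z₀ K n
      (fun w y => ({z} : Set Z).indicator 1 (w ⟨n, Finset.mem_Iic.2 le_rfl⟩)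
        * ((K z).supportᶜ : Set Z).indicator 1 y)
      (((measurable_one.indicator hB).comp
        ((measurable_pi_apply (⟨n, Finset.mem_Iic.2 le_rfl⟩ : Finset.Iic n)).comp
          measurable_fst)).mul ((measurable_one.indicator hB').comp measurable_snd))
    have h0 : ∫⁻ ω, ∑' y, K (ω n) y * (({z} : Set Z).indicator 1 (ω n)
        * ((K z).supportᶜ : Set Z).indicator 1 y) ∂chainMeasure z₀ K = 0 := by
      refine (lintegral_congr fun ω => ?_).trans lintegral_zero
      refine ENNReal.tsum_eq_zero.2 fun y => ?_
      by_cases h1 : ω n = z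
      · by_cases h2 : y ∈ (K z).support
        · simp [h2]
        · rw [PMF.mem_support_iff, not_not] at h2
          simp [h1, h2]
      · simp [h1]
    have h3 := h.trans h0
    rw [lintegral_eq_zero_iff (by
      exact ((measurable_one.indicator hB).comp (measurable_pi_apply n)).mul
        ((measurable_one.indicator hB').comp (measurable_pi_apply (n + 1))))] at h3
    filter_upwards [h3] with ω hω hz
    by_contra hc
    simp only [Preorder.frestrictLe_apply, Pi.zero_apply, mul_eq_zero] at hω
    rcases hω with hω | hω
    · simp [hz] at hω
    · rw [Set.indicator_of_mem (by exact hc)] at hω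
      simp at hω
  have h' := (ae_ball_iff (PMF.support_countable (chainLaw z₀ K n))).2 h
  filter_upwards [h', ae_chainMeasure_mem_support_chainLaw z₀ K n] with ω h1 h2
  exact h1 _ h2 rfl

/-- Ville's inequality for a nonnegative function that is excessive for the chain. -/
theorem mul_measure_exists_le (z₀ : Z) (K : Z → PMF Z) (W : Z → ℝ≥0∞)
    (hW : ∀ z, ∑' y, K z y * W y ≤ W z) (c : ℝ≥0∞) :
    c * chainMeasure z₀ K {ω | ∃ n, c ≤ W (ω n)} ≤ W z₀ := by
  set μ := chainMeasure z₀ K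
  have mW : ∀ n, Measurable fun ω : ℕ → Z => W (ω n) := fun n =>
    (Measurable.of_discrete (f := W)).comp (measurable_pi_apply n)
  -- Paths that have not reached level c before time n.
  set G : ℕ → Set (ℕ → Z) := fun n => {ω | ∀ k < n, W (ω k) < c}
  have mG : ∀ n, MeasurableSet (G n) := by
    intro n
    have : G n = ⋂ k, ⋂ (_ : k < n), {ω | W (ω k) < c} := by ext ω; simp [G]
    rw [this]
    exact MeasurableSet.iInter fun k => MeasurableSet.iInter fun _ =>
      measurableSet_lt (mW k) measurable_const
  have hsucc : ∀ n, G (n + 1) = G n ∩ {ω | W (ω n) < c} := by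
    intro n; ext ω
    simp only [G, Set.mem_ofPred_eq, Set.mem_inter_iff]
    refine ⟨fun h => ⟨fun k hk => h k (by omega), h n (by omega)⟩, fun h k hk => ?_⟩
    rcases Nat.lt_succ_iff_lt_or_eq.1 hk with h1 | h1
    · exact h.1 k h1
    · exact h1 ▸ h.2
  -- Optional stopping as an invariant: the paths still below c carry their current W, and those
  -- that have crossed carry c.
  have key : ∀ n, ∫⁻ ω in G n, W (ω n) ∂μ + c * μ (G n)ᶜ ≤ W z₀ := by
    intro n
    induction n with
    | zero =>
      have h0 : G 0 = Set.univ := by ext ω; simp [G]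
      have h1 : ∫⁻ ω, W (ω 0) ∂μ = W z₀ := by
        rw [← lintegral_map (μ := μ) (g := fun ω => ω 0) (f := W) Measurable.of_discrete
          (measurable_pi_apply 0), map_chainMeasure, chainLaw, PMF.toMeasure_pure, lintegral_dirac]
      simp [h0, h1]
    | succ n ih =>
      have hstep : ∫⁻ ω in G (n + 1), W (ω (n + 1)) ∂μ ≤ ∫⁻ ω in G (n + 1), W (ω n) ∂μ := by
        -- `G (n + 1)` only involves times up to n, so it is an event of the past and the Markov
        -- property applies to it.
        set G' : Set ((i : Finset.Iic n) → (fun _ : ℕ => Z) i) := {w | ∀ i, W (w i) < c}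
        have mG' : MeasurableSet G' := by
          have : G' = ⋂ i, {w | W (w i) < c} := by ext ω; simp [G']
          rw [this]
          exact MeasurableSet.iInter fun i => measurableSet_lt
            ((Measurable.of_discrete (f := W)).comp (measurable_pi_apply i)) measurable_const
        have hGG : ∀ ω, ω ∈ G (n + 1) ↔ Preorder.frestrictLe n ω ∈ G' := by
          intro ω
          simp only [G, G', Set.mem_ofPred_eq, Preorder.frestrictLe_apply, Subtype.forall,
            Finset.mem_Iic, Nat.lt_succ_iff]
        have hind : ∀ ω, (G (n + 1)).indicator (1 : (ℕ → Z) → ℝ≥0∞) ω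
            = G'.indicator 1 (Preorder.frestrictLe n ω) := by
          intro ω
          by_cases h : ω ∈ G (n + 1)
          · simp [h, (hGG ω).1 h]
          · simp [h, mt (hGG ω).2 h]
        have hmul : ∀ (F : (ℕ → Z) → ℝ≥0∞), ∫⁻ ω in G (n + 1), F ω ∂μ
            = ∫⁻ ω, G'.indicator 1 (Preorder.frestrictLe n ω) * F ω ∂μ := by
          intro F
          rw [← lintegral_indicator (mG _)]
          refine lintegral_congr fun ω => ?_
          rw [← hind]
          by_cases h : ω ∈ G (n + 1) <;> simp [h]
        rw [hmul, hmul]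
        refine (lintegral_chainMeasure_succ z₀ K n (fun w y => G'.indicator 1 w * W y)
          (((measurable_one.indicator mG').comp measurable_fst).mul
            ((Measurable.of_discrete (f := W)).comp measurable_snd))).trans_le ?_
        refine lintegral_mono fun ω => ?_
        simp_rw [mul_left_comm _ (G'.indicator _ _) _]
        rw [ENNReal.tsum_mul_left]
        exact mul_le_mul_right (hW _) _
      have hsplit : ∫⁻ ω in G n, W (ω n) ∂μ = ∫⁻ ω in G (n + 1), W (ω n) ∂μ
          + ∫⁻ ω in G n \ G (n + 1), W (ω n) ∂μ := by
        rw [← lintegral_inter_add_sdiff (μ := μ) (fun ω => W (ω n)) (G n) (mG (n + 1)),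
          Set.inter_eq_self_of_subset_right (by rw [hsucc]; exact Set.inter_subset_left)]
      have hdiff : c * μ (G n \ G (n + 1)) ≤ ∫⁻ ω in G n \ G (n + 1), W (ω n) ∂μ := by
        rw [← setLIntegral_const]
        refine setLIntegral_mono (mW n) fun ω hω => ?_
        rw [hsucc] at hω
        by_contra hc
        exact hω.2 ⟨hω.1, not_le.1 hc⟩
      have hcompl : μ (G (n + 1))ᶜ ≤ μ (G n \ G (n + 1)) + μ (G n)ᶜ := by
        refine (measure_mono fun ω hω => ?_).trans (measure_union_le _ _)
        by_cases h : ω ∈ G n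
        · exact Or.inl ⟨h, hω⟩
        · exact Or.inr h
      calc ∫⁻ ω in G (n + 1), W (ω (n + 1)) ∂μ + c * μ (G (n + 1))ᶜ
          ≤ ∫⁻ ω in G (n + 1), W (ω n) ∂μ + c * (μ (G n \ G (n + 1)) + μ (G n)ᶜ) := by gcongr
        _ = (∫⁻ ω in G (n + 1), W (ω n) ∂μ + c * μ (G n \ G (n + 1))) + c * μ (G n)ᶜ := by
            rw [mul_add, add_assoc]
        _ ≤ ∫⁻ ω in G n, W (ω n) ∂μ + c * μ (G n)ᶜ := by rw [hsplit]; gcongr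
        _ ≤ W z₀ := ih
  have hU : {ω | ∃ n, c ≤ W (ω n)} = ⋃ n, (G n)ᶜ := by
    ext ω
    simp only [G, Set.mem_ofPred_eq, Set.mem_iUnion, Set.mem_compl_iff, not_forall, not_lt]
    exact ⟨fun ⟨n, hn⟩ => ⟨n + 1, n, n.lt_succ_self, hn⟩, fun ⟨_, k, _, hk⟩ => ⟨k, hk⟩⟩
  have hmono : Monotone fun n => (G n)ᶜ := fun m n hmn ω hω h =>
    hω fun k hk => h k (hk.trans_le hmn)
  rw [hU, hmono.measure_iUnion, ENNReal.mul_iSup]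
  exact iSup_le fun n => le_add_self.trans (key n)

/-- Ville's inequality at every integer level c gives c · P(unbounded) ≤ W z₀ < ∞, which forces the
probability to vanish. -/
theorem ae_chainMeasure_bounded (z₀ : Z) (K : Z → PMF Z) (W : Z → ℝ≥0∞) (h0 : W z₀ ≠ ∞)
    (hW : ∀ z, ∑' y, K z y * W y ≤ W z) :
    ∀ᵐ ω ∂chainMeasure z₀ K, ∃ c : ℕ, ∀ n, W (ω n) ≤ c := by
  have hle : ∀ c : ℕ, (c : ℝ≥0∞) * chainMeasure z₀ K {ω | ¬ ∃ c : ℕ, ∀ n, W (ω n) ≤ c}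
      ≤ W z₀ := by
    intro c
    refine le_trans ?_ (mul_measure_exists_le z₀ K W hW c)
    gcongr
    intro h
    obtain ⟨n, hn⟩ := not_forall.1 (not_exists.1 h c)
    exact ⟨n, (not_le.1 hn).le⟩
  rw [ae_iff]
  by_contra hne
  have h1 : Tendsto (fun c : ℕ => (c : ℝ≥0∞)
      * chainMeasure z₀ K {ω | ¬ ∃ c : ℕ, ∀ n, W (ω n) ≤ c}) atTop (𝓝 ∞) := by
    have := ENNReal.Tendsto.mul_const (b := chainMeasure z₀ K
      {ω | ¬ ∃ c : ℕ, ∀ n, W (ω n) ≤ c}) ENNReal.tendsto_nat_nhds_top (Or.inl ENNReal.top_ne_zero)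
    rwa [ENNReal.top_mul hne] at this
  exact h0 (top_le_iff.1 (le_of_tendsto' h1 hle))

end Chain

/-- A Markov chain with discrete transition laws lives on some probability space, where excessive
functions stay almost surely bounded along it. -/
theorem exists_chain {Z : Type*} (z₀ : Z) (K : Z → PMF Z) :
    ∃ (m : MeasurableSpace (ℕ → Z)) (μ : @Measure (ℕ → Z) m),
      (∀ n (B : Set Z), MeasurableSet[m] {ω : ℕ → Z | ω n ∈ B} ∧
        μ {ω | ω n ∈ B} = (chainLaw z₀ K n).toOuterMeasure B) ∧
      IsProbabilityMeasure μ ∧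
      (∀ᵐ ω ∂μ, ω 0 = z₀ ∧ ∀ n, ω (n + 1) ∈ (K (ω n)).support) ∧
      ∀ W : Z → ℝ≥0∞, W z₀ ≠ ∞ → (∀ z, ∑' y, K z y * W y ≤ W z) →
        ∀ᵐ ω ∂μ, ∃ c : ℕ, ∀ n, W (ω n) ≤ c := by
  -- With the discrete σ-algebra every functional of a tree is measurable. It stays inside the
  -- existential, so users need no measurable structure on trees.
  let _ : MeasurableSpace Z := ⊤
  have : DiscreteMeasurableSpace Z := ⟨fun _ => trivial⟩
  refine ⟨inferInstance, chainMeasure z₀ K, fun n B => ?_, inferInstance, ?_,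
    fun W h0 hW => ae_chainMeasure_bounded z₀ K W h0 hW⟩
  · have hB : MeasurableSet B := MeasurableSet.of_discrete
    refine ⟨measurable_pi_apply n hB, ?_⟩
    rw [← PMF.toMeasure_apply_eq_toOuterMeasure_apply _ hB, ← map_chainMeasure,
      Measure.map_apply (measurable_pi_apply n) hB]
    rfl
  · filter_upwards [ae_chainMeasure_mem_support_chainLaw z₀ K 0, ae_chainMeasure_support z₀ K]
      with ω h1 h2
    exact ⟨by simpa [chainLaw] using h1, h2⟩

end GUMDP

namespace GUMDP

/-! ### Bandits played by confidence indices: pathwise convergence -/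

section Bandit

variable {A : Type*} [Fintype A]

/-- A run of a bandit algorithm: `N n a` and `S n a` are the number of plays and the sum of the
returns of arm `a` at time `n`. At each time either no arm is played, or one arm is played, which
is untried or has the least confidence index. -/
structure IsIndexRun (Cp : ℝ) (N : ℕ → A → ℕ) (S : ℕ → A → ℝ) : Prop where
  step : ∀ n, N (n + 1) = N n ∨ ∃ a, N (n + 1) a = N n a + 1 ∧ (∀ b ≠ a, N (n + 1) b = N n b) ∧
    (N n a = 0 ∨ ∀ b, N n b ≠ 0 ∧
      S n a / N n a - 2 * Cp * √(Real.log ((∑ c, N n c : ℕ) : ℝ) / N n a)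
        ≤ S n b / N n b - 2 * Cp * √(Real.log ((∑ c, N n c : ℕ) : ℝ) / N n b))
  sum_eq : ∀ n a, N (n + 1) a = N n a → S (n + 1) a = S n a

theorem eventually_const_of_bounded {u : ℕ → ℕ} (hu : Monotone u) {m : ℕ} (hm : ∀ n, u n ≤ m) :
    ∃ n₀, ∀ n ≥ n₀, u n = u n₀ := by
  obtain ⟨n₀, h₀⟩ : ∃ n₀, ∀ n, u n ≤ u n₀ := by
    have hfin : (Set.range u).Finite := (Set.finite_Iic m).subset (by rintro _ ⟨n, rfl⟩; exact hm n)
    obtain ⟨_, ⟨n₀, rfl⟩, h⟩ := hfin.exists_maximalFor id _ (Set.range_nonempty u)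
    refine ⟨n₀, fun n => ?_⟩
    by_contra hc
    exact hc (h ⟨n, rfl⟩ (not_le.1 hc).le)
  exact ⟨n₀, fun n hn => le_antisymm (h₀ n) (hu hn)⟩

theorem frequently_ne_succ {u : ℕ → ℕ} (hu : Tendsto u atTop atTop) :
    ∃ᶠ n in atTop, u (n + 1) ≠ u n := by
  intro hc
  obtain ⟨n₀, h₀⟩ := eventually_atTop.1 hc
  have hconst : ∀ n ≥ n₀, u n = u n₀ := by
    intro n hn
    induction n, hn using Nat.le_induction with
    | base => rfl
    | succ n hn ih => rw [not_not.1 (h₀ n hn), ih]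
  obtain ⟨n, hn, hn'⟩ := ((hu.eventually_gt_atTop (u n₀)).and (eventually_ge_atTop n₀)).exists
  rw [hconst n hn'] at hn
  exact lt_irrefl _ hn

namespace IsIndexRun

variable {Cp : ℝ} {N : ℕ → A → ℕ} {S : ℕ → A → ℝ} (h : IsIndexRun Cp N S)
include h

theorem monotone (a : A) : Monotone fun n => N n a := by
  refine monotone_nat_of_le_succ fun n => ?_
  rcases h.step n with h1 | ⟨b, h1, h2, -⟩
  · rw [h1]
  · by_cases hab : a = b
    · subst hab; omega
    · rw [h2 a hab]

theorem sum_const {a : A} {n₀ : ℕ} (hc : ∀ n ≥ n₀, N n a = N n₀ a) :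
    ∀ n ≥ n₀, S n a = S n₀ a := by
  intro n hn
  induction n, hn using Nat.le_induction with
  | base => rfl
  | succ n hn ih => rw [h.sum_eq n a (by rw [hc n hn, hc (n + 1) (by omega)]), ih]

theorem index_le_of_played {n : ℕ} {a : A} (ha : N (n + 1) a ≠ N n a) (h0 : N n a ≠ 0) (b : A) :
    N n b ≠ 0 ∧ S n a / N n a - 2 * Cp * √(Real.log ((∑ c, N n c : ℕ) : ℝ) / N n a)
        ≤ S n b / N n b - 2 * Cp * √(Real.log ((∑ c, N n c : ℕ) : ℝ) / N n b) := by
  rcases h.step n with h1 | ⟨a', _, h2, h3⟩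
  · exact absurd (congrFun h1 a) ha
  · have : a = a' := by by_contra hc; exact ha (h2 a hc)
    subst this
    exact (h3.resolve_left h0) b

theorem bounded_or_tendsto (a : A) :
    (∃ m, ∀ n, N n a ≤ m) ∨ Tendsto (fun n => N n a) atTop atTop := by
  by_cases hb : ∃ m, ∀ n, N n a ≤ m
  · exact Or.inl hb
  · push Not at hb
    exact Or.inr (tendsto_atTop_atTop_of_monotone (h.monotone a)
      fun m => (hb m).imp fun _ hn => hn.le)

variable {q : A → ℝ}
  (hq : ∀ a, Tendsto (fun n => N n a) atTop atTop →
    Tendsto (fun n => S n a / N n a) atTop (𝓝 (q a)))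
  (hN : Tendsto (fun n => ∑ a, N n a) atTop atTop)
include hq hN

/-- Every arm is played infinitely often. -/
theorem tendsto_count (hCp : 0 < Cp) (a : A) : Tendsto (fun n => N n a) atTop atTop := by
  refine (h.bounded_or_tendsto a).resolve_left ?_
  rintro ⟨m, hm⟩
  obtain ⟨b, hb⟩ : ∃ b, Tendsto (fun n => N n b) atTop atTop := by
    by_contra hc
    push Not at hc
    choose M hM using fun b => (h.bounded_or_tendsto b).resolve_right (hc b)
    obtain ⟨n, hn⟩ := (hN.eventually_gt_atTop (∑ b, M b)).exists
    exact absurd (Finset.sum_le_sum fun b _ => hM b n) (not_le.2 hn)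
  obtain ⟨n₀, h₀⟩ := eventually_const_of_bounded (h.monotone a) hm
  have hS := h.sum_const h₀
  set c : ℝ := S n₀ a / N n₀ a
  set M : ℝ := m + 1
  have hM : 0 < M := by positivity
  have hs : Tendsto (fun n => √(Real.log ((∑ a, N n a : ℕ) : ℝ))) atTop atTop :=
    Real.tendsto_sqrt_atTop.comp
      (Real.tendsto_log_atTop.comp (tendsto_natCast_atTop_atTop.comp hN))
  -- Look at a late play of b. Having at least 4(m + 1) plays makes the bonus of b at most half of
  -- √(l/M), while the bonus of a is at least √(l/M). The surplus Cp·√(l/M) then exceeds c − q b +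
  -- 1, contradicting that b had the least index.
  have hev := (hs.eventually_gt_atTop ((c - q b + 1) * √M / Cp)).and
    ((eventually_ge_atTop n₀).and ((hb.eventually_ge_atTop (4 * (m + 1))).and
    ((hq b hb).eventually (lt_mem_nhds (show q b - 1 < q b by linarith)))))
  obtain ⟨n, hplay, hlog, hn, hNb, hmean⟩ := ((frequently_ne_succ hb).and_eventually hev).exists
  obtain ⟨hNa, hidx⟩ := h.index_le_of_played hplay (by omega) a
  rw [show S n a / N n a = c by rw [hS n hn, h₀ n hn]] at hidx
  set l := Real.log ((∑ a, N n a : ℕ) : ℝ)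
  have hl : 0 ≤ l := Real.log_natCast_nonneg _
  have hNa' : (0 : ℝ) < N n a := by exact_mod_cast Nat.pos_of_ne_zero hNa
  have h1 : √l / √M ≤ √(l / N n a) := by
    rw [← Real.sqrt_div hl]
    refine Real.sqrt_le_sqrt (div_le_div_of_nonneg_left hl hNa' ?_)
    have : (N n a : ℝ) ≤ m := by exact_mod_cast hm n
    linarith
  have h2 : √(l / N n b) ≤ √l / √M / 2 := by
    have h4 : √l / √M / 2 = √(l / (4 * M)) := by
      rw [Real.sqrt_div hl, Real.sqrt_mul (by norm_num), show (4 : ℝ) = 2 ^ 2 by norm_num,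
        Real.sqrt_sq (by norm_num), div_div, mul_comm]
    rw [h4]
    refine Real.sqrt_le_sqrt (div_le_div_of_nonneg_left hl (by positivity) ?_)
    have : ((4 * (m + 1) : ℕ) : ℝ) ≤ N n b := by exact_mod_cast hNb
    push_cast at this
    exact this
  have h3 : (c - q b + 1) < Cp * (√l / √M) := by
    rw [div_lt_iff₀ hCp] at hlog
    rw [← mul_div_assoc, lt_div_iff₀ (Real.sqrt_pos.2 hM)]
    linarith
  have h5 := mul_le_mul_of_nonneg_left h1 hCp.le
  have h6 := mul_le_mul_of_nonneg_left h2 hCp.le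
  linarith

/-- The plays of a suboptimal arm are a vanishing fraction of all plays. -/
theorem tendsto_count_div (hCp : 0 < Cp) {a b : A} (hab : q b < q a) :
    Tendsto (fun n => (N n a : ℝ) / ((∑ c, N n c : ℕ) : ℝ)) atTop (𝓝 0) := by
  have ha := h.tendsto_count hq hN hCp a
  have hb := h.tendsto_count hq hN hCp b
  set Δ := q a - q b
  have hΔ : 0 < Δ := sub_pos.2 hab
  have hev := ((hq a ha).eventually (lt_mem_nhds (show q a - Δ / 4 < q a by linarith))).and
    (((hq b hb).eventually (gt_mem_nhds (show q b < q b + Δ / 4 by linarith))).and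
    (ha.eventually_ge_atTop 1))
  obtain ⟨n₀, h₀⟩ := eventually_atTop.1 hev
  -- Once both means are within Δ/4 of their limits, a play of a requires Δ/2 ≤ 2·Cp·√(l/N a), that
  -- is, N a ≤ C·l. Hence the count of a is at most logarithmic.
  set C : ℝ := (4 * Cp / Δ) ^ 2
  have hC : 0 ≤ C := sq_nonneg _
  have hsum : Monotone fun n => ∑ c, N n c := fun i j hij =>
    Finset.sum_le_sum fun c _ => h.monotone c hij
  have hbound : ∀ n ≥ n₀, (N n a : ℝ) ≤ N n₀ a + 1 + C * Real.log ((∑ c, N n c : ℕ) : ℝ) := by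
    intro n hn
    induction n, hn using Nat.le_induction with
    | base =>
      have := mul_nonneg hC (Real.log_natCast_nonneg (∑ c, N n₀ c))
      linarith
    | succ n hn ih =>
      obtain ⟨hma, hmb, hNa⟩ := h₀ n hn
      have hpos : 0 < ∑ c, N n c :=
        lt_of_lt_of_le (by omega : 0 < N n a)
          (Finset.single_le_sum (f := fun c => N n c) (fun _ _ => Nat.zero_le _) (Finset.mem_univ a))
      have hlog : Real.log ((∑ c, N n c : ℕ) : ℝ) ≤ Real.log ((∑ c, N (n + 1) c : ℕ) : ℝ) :=
        Real.log_le_log (by exact_mod_cast hpos) (by exact_mod_cast hsum n.le_succ)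
      have hlog' := mul_le_mul_of_nonneg_left hlog hC
      by_cases hplay : N (n + 1) a = N n a
      · rw [hplay]; linarith
      · have hle : N (n + 1) a ≤ N n a + 1 := by
          rcases h.step n with h1 | ⟨a', h1, h2, -⟩
          · rw [h1]; omega
          · by_cases hc : a = a'
            · subst hc; omega
            · rw [h2 a hc]; omega
        have hle' : (N (n + 1) a : ℝ) ≤ N n a + 1 := by exact_mod_cast hle
        have hidx := (h.index_le_of_played hplay (by omega) b).2
        set l := Real.log ((∑ c, N n c : ℕ) : ℝ)
        have hl : 0 ≤ l := Real.log_natCast_nonneg _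
        have hNa' : (0 : ℝ) < N n a := by exact_mod_cast hNa
        have h1 : 0 ≤ 2 * Cp * √(l / N n b) := by positivity
        have h2 : Δ ≤ 4 * Cp * √(l / N n a) := by
          have : Δ = q a - q b := rfl
          linarith
        have h3 : (N n a : ℝ) ≤ C * l := by
          have h4 : Δ ^ 2 ≤ (4 * Cp) ^ 2 * (l / N n a) := by
            rw [← Real.sq_sqrt (show 0 ≤ l / N n a by positivity), ← mul_pow]
            exact pow_le_pow_left₀ hΔ.le h2 2
          rw [← mul_div_assoc, le_div_iff₀ hNa'] at h4
          simp only [C, div_pow]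
          rw [div_mul_eq_mul_div, le_div_iff₀ (by positivity)]
          linarith
        have h0' : (0 : ℝ) ≤ N n₀ a := by positivity
        linarith
  have hlim : Tendsto (fun n => ((N n₀ a : ℝ) + 1) / ((∑ c, N n c : ℕ) : ℝ)
      + C * (Real.log ((∑ c, N n c : ℕ) : ℝ) / ((∑ c, N n c : ℕ) : ℝ))) atTop (𝓝 0) := by
    have hcast : Tendsto (fun n => ((∑ c, N n c : ℕ) : ℝ)) atTop atTop :=
      tendsto_natCast_atTop_atTop.comp hN
    have h1 := hcast.const_div_atTop ((N n₀ a : ℝ) + 1)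
    have h2 := (Real.isLittleO_log_id_atTop.tendsto_div_nhds_zero.comp hcast).const_mul C
    simpa using h1.add h2
  refine squeeze_zero' (Eventually.of_forall fun n => by positivity) ?_ hlim
  filter_upwards [eventually_ge_atTop n₀] with n hn
  rw [← mul_div_assoc, ← add_div]
  exact div_le_div_of_nonneg_right (hbound n hn) (by positivity)

/-- The overall average return tends to the value of the best arm. -/
theorem tendsto_total [Nonempty A] (hCp : 0 < Cp) :
    Tendsto (fun n => (∑ a, S n a) / ((∑ a, N n a : ℕ) : ℝ)) atTop (𝓝 (⨅ a, q a)) := by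
  obtain ⟨b, hb⟩ := exists_eq_ciInf_of_finite (f := q)
  -- The overall average minus q b is the sum over arms of frequency times (mean − q b). For a
  -- suboptimal arm the frequency vanishes, for an optimal one the second factor does.
  have hterm : ∀ a, Tendsto (fun n => (N n a : ℝ) / ((∑ c, N n c : ℕ) : ℝ)
      * (S n a / N n a - q b)) atTop (𝓝 0) := by
    intro a
    have hconv := (hq a (h.tendsto_count hq hN hCp a)).sub_const (q b)
    rcases (hb.trans_le (ciInf_le (Set.finite_range q).bddBelow a)).lt_or_eq with hlt | heq
    · simpa using (h.tendsto_count_div hq hN hCp hlt).mul hconv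
    · rw [heq, sub_self, ← heq] at hconv
      refine bdd_le_mul_tendsto_zero' 1 (Eventually.of_forall fun n => ?_) hconv
      rw [abs_of_nonneg (by positivity)]
      refine div_le_one_of_le₀ ?_ (by positivity)
      exact_mod_cast Finset.single_le_sum (f := fun c => N n c) (fun _ _ => Nat.zero_le _)
        (Finset.mem_univ a)
  have hsum := (tendsto_finsetSum Finset.univ fun a _ => hterm a).add_const (q b)
  rw [← hb]
  simp only [Finset.sum_const_zero, zero_add] at hsum
  refine hsum.congr' ?_
  have hall : ∀ᶠ n in atTop, ∀ a, 1 ≤ N n a :=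
    eventually_all.2 fun a => (h.tendsto_count hq hN hCp a).eventually_ge_atTop 1
  filter_upwards [hall] with n hn
  have hpos : (0 : ℝ) < ((∑ c, N n c : ℕ) : ℝ) := by
    have : 0 < ∑ c, N n c := Finset.sum_pos (fun a _ => hn a) Finset.univ_nonempty
    exact_mod_cast this
  have h1 : ∀ a, (N n a : ℝ) / ((∑ c, N n c : ℕ) : ℝ) * (S n a / N n a - q b)
      = (S n a - N n a * q b) / ((∑ c, N n c : ℕ) : ℝ) := by
    intro a
    have : (N n a : ℝ) ≠ 0 := by exact_mod_cast (Nat.one_le_iff_ne_zero.1 (hn a))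
    field_simp
  simp_rw [h1]
  rw [← Finset.sum_div, Finset.sum_sub_distrib, ← Finset.sum_mul, sub_div, Nat.cast_sum]
  rw [Nat.cast_sum] at hpos
  field_simp
  ring

end IsIndexRun

end Bandit

end GUMDP

namespace GUMDP

open scoped ENNReal

/-! ### Expectations under probability mass functions -/

section Lexpect

/-- Expectation of a nonnegative extended real function. -/
noncomputable def lexpect {Z : Type*} (p : PMF Z) (W : Z → ℝ≥0∞) : ℝ≥0∞ := ∑' z, p z * W z

variable {Z Y : Type*}

theorem lexpect_bind (p : PMF Z) (q : Z → PMF Y) (W : Y → ℝ≥0∞) :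
    lexpect (p.bind q) W = lexpect p fun z => lexpect (q z) W := by
  simp only [lexpect, PMF.bind_apply, ← ENNReal.tsum_mul_right, ← ENNReal.tsum_mul_left]
  rw [ENNReal.tsum_comm]
  simp only [mul_assoc]

theorem lexpect_pure (z : Z) (W : Z → ℝ≥0∞) : lexpect (PMF.pure z) W = W z := by
  rw [lexpect, tsum_eq_single z]
  · simp
  · intro y hy; simp [PMF.pure_apply_of_ne _ _ hy]

theorem lexpect_map (p : PMF Z) (φ : Z → Y) (W : Y → ℝ≥0∞) :
    lexpect (p.map φ) W = lexpect p fun z => W (φ z) := by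
  rw [← PMF.bind_pure_comp, lexpect_bind]
  simp only [Function.comp_apply, lexpect_pure]

theorem lexpect_mono_support {p : PMF Z} {W W' : Z → ℝ≥0∞} (h : ∀ z ∈ p.support, W z ≤ W' z) :
    lexpect p W ≤ lexpect p W' := by
  refine ENNReal.tsum_le_tsum fun z => ?_
  by_cases hz : z ∈ p.support
  · exact mul_le_mul_right (h z hz) _
  · rw [PMF.mem_support_iff, not_not] at hz
    simp [hz]

theorem lexpect_const (p : PMF Z) (c : ℝ≥0∞) : lexpect p (fun _ => c) = c := by
  rw [lexpect, ENNReal.tsum_mul_right, p.tsum_coe, one_mul]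

theorem lexpect_le {p : PMF Z} {W : Z → ℝ≥0∞} {c : ℝ≥0∞} (h : ∀ z ∈ p.support, W z ≤ c) :
    lexpect p W ≤ c :=
  (lexpect_mono_support h).trans_eq (lexpect_const p c)

theorem expect_eq_sum {p : PMF Z} (hp : p.support.Finite) (g : Z → ℝ) :
    expect p g = ∑ z ∈ hp.toFinset, (p z).toReal * g z := by
  refine tsum_eq_sum fun z hz => ?_
  rw [Set.Finite.mem_toFinset, PMF.mem_support_iff, not_not] at hz
  simp [hz]

theorem sum_toReal_eq_one {p : PMF Z} (hp : p.support.Finite) :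
    ∑ z ∈ hp.toFinset, (p z).toReal = 1 := by
  rw [← ENNReal.toReal_sum fun z _ => p.apply_ne_top z, ← tsum_eq_sum (L := .unconditional Z),
    p.tsum_coe, ENNReal.toReal_one]
  intro z hz
  rwa [Set.Finite.mem_toFinset, PMF.mem_support_iff, not_not] at hz

theorem lexpect_ofReal {p : PMF Z} (hp : p.support.Finite) {g : Z → ℝ} (hg : ∀ z, 0 ≤ g z) :
    lexpect p (fun z => ENNReal.ofReal (g z)) = ENNReal.ofReal (expect p g) := by
  rw [expect_eq_sum hp, ENNReal.ofReal_sum_of_nonneg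
    fun z _ => mul_nonneg ENNReal.toReal_nonneg (hg z), lexpect, tsum_eq_sum (s := hp.toFinset)]
  · refine Finset.sum_congr rfl fun z _ => ?_
    rw [ENNReal.ofReal_mul ENNReal.toReal_nonneg, ENNReal.ofReal_toReal (p.apply_ne_top z)]
  · intro z hz
    rw [Set.Finite.mem_toFinset, PMF.mem_support_iff, not_not] at hz
    simp [hz]

/-- Exponential moment bound for a bounded centred function. -/
theorem expect_exp_le {p : PMF Z} (hp : p.support.Finite) {h : Z → ℝ} (h0 : expect p h = 0)
    {B lam : ℝ} (hB : ∀ z ∈ p.support, |h z| ≤ B) (hl : |lam| * B ≤ 1) :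
    expect p (fun z => Real.exp (lam * h z)) ≤ Real.exp (lam ^ 2 * B ^ 2) := by
  have hB' : ∀ z ∈ hp.toFinset, |h z| ≤ B := fun z hz => hB z (hp.mem_toFinset.1 hz)
  rw [expect_eq_sum hp] at h0 ⊢
  calc ∑ z ∈ hp.toFinset, (p z).toReal * Real.exp (lam * h z)
      -- Uses exp u ≤ 1 + u + u² for |u| ≤ 1; the linear term has mean zero.
      ≤ ∑ z ∈ hp.toFinset, (p z).toReal * (1 + lam * h z + lam ^ 2 * B ^ 2) := by
        refine Finset.sum_le_sum fun z hz => mul_le_mul_of_nonneg_left ?_ ENNReal.toReal_nonneg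
        have h1 : |lam * h z| ≤ 1 := by
          rw [abs_mul]
          exact (mul_le_mul_of_nonneg_left (hB' z hz) (abs_nonneg _)).trans hl
        have h2 := (abs_le.1 (Real.abs_exp_sub_one_sub_id_le h1)).2
        have h3 : (lam * h z) ^ 2 ≤ lam ^ 2 * B ^ 2 := by
          rw [mul_pow]
          exact mul_le_mul_of_nonneg_left (sq_le_sq' (abs_le.1 (hB' z hz)).1
            (abs_le.1 (hB' z hz)).2) (sq_nonneg _)
        linarith
    _ = (∑ z ∈ hp.toFinset, (p z).toReal) * (1 + lam ^ 2 * B ^ 2)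
          + lam * ∑ z ∈ hp.toFinset, (p z).toReal * h z := by
        rw [Finset.sum_mul, Finset.mul_sum, ← Finset.sum_add_distrib]
        exact Finset.sum_congr rfl fun z _ => by ring
    _ = lam ^ 2 * B ^ 2 + 1 := by rw [sum_toReal_eq_one hp, h0]; ring
    _ ≤ _ := Real.add_one_le_exp _

end Lexpect

/-! ### One iteration of the tree search -/

section Iteration

variable {X A : Type*} [Fintype A] (M : MDP X A) (θ : UCTParams X A)

/-- What happens in an iteration below node `p` once action `a` has been played and `y` sampled. -/
noncomputable def descend (T : Tree X A) (k : ℕ) (p : List (A × X)) (a : A) (y : X) :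
    PMF (ℝ × Tree X A) :=
  if (T p a).1 = 0 then (rolloutReturn M θ k y).map fun g => (g, T)
  else iteration M θ T k ((a, y) :: p) y

theorem iteration_succ (T : Tree X A) (k : ℕ) (p : List (A × X)) (x : X) :
    iteration M θ T (k + 1) p x = (T.choose θ p).bind fun a => (M.step x a).bind fun y =>
      (descend M θ T k p a y).map fun r => (M.cost x + r.1, r.2.record p a (M.cost x + r.1)) := by
  rw [iteration]; rfl

omit [Fintype A] in
theorem record_of_ne (T : Tree X A) {p q : List (A × X)} (h : q ≠ p) (a : A) (g : ℝ) :
    T.record p a g q = T q := by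
  funext b; simp [Tree.record, h]

omit [Fintype A] in
theorem record_self (T : Tree X A) (p : List (A × X)) (a : A) (g : ℝ) :
    T.record p a g p a = ((T p a).1 + 1, (T p a).2 + g) := by
  simp [Tree.record]

omit [Fintype A] in
theorem record_of_ne_action (T : Tree X A) (p : List (A × X)) {a b : A} (h : b ≠ a) (g : ℝ) :
    T.record p a g p b = T p b := by
  simp [Tree.record, h]

/-- Total return at a node. -/
noncomputable def Tree.total (T : Tree X A) (p : List (A × X)) : ℝ := ∑ a, (T p a).2

theorem visits_record (T : Tree X A) (p : List (A × X)) (a : A) (g : ℝ) :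
    (T.record p a g).visits p = T.visits p + 1 := by
  classical
  have h : ∀ b, (T.record p a g p b).1 = (T p b).1 + if b = a then 1 else 0 := by
    intro b
    by_cases hb : b = a
    · subst hb; simp [record_self]
    · simp [record_of_ne_action T p hb, hb]
  simp [Tree.visits, h, Finset.sum_add_distrib]

theorem total_record (T : Tree X A) (p : List (A × X)) (a : A) (g : ℝ) :
    (T.record p a g).total p = T.total p + g := by
  classical
  have h : ∀ b, (T.record p a g p b).2 = (T p b).2 + if b = a then g else 0 := by
    intro b
    by_cases hb : b = a
    · subst hb; simp [record_self]
    · simp [record_of_ne_action T p hb, hb]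
  simp [Tree.total, h, Finset.sum_add_distrib]

theorem visits_congr {T T' : Tree X A} {p : List (A × X)} (h : T' p = T p) :
    T'.visits p = T.visits p := by
  simp [Tree.visits, h]

theorem total_congr {T T' : Tree X A} {p : List (A × X)} (h : T' p = T p) :
    T'.total p = T.total p := by
  simp [Tree.total, h]

omit [Fintype A] in
theorem not_cons_suffix_self (z : A × X) (p : List (A × X)) : ¬ (z :: p) <:+ p := fun h => by
  simpa using h.length_le

omit [Fintype A] in
-- Since paths are stored most recent first, the subtree of a node is the set of lists having it as
-- a suffix. This says that the subtrees of distinct children are disjoint.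
theorem eq_of_cons_suffix {z z' : A × X} {p q : List (A × X)} (h : (z :: p) <:+ q)
    (h' : (z' :: p) <:+ q) : z = z' := by
  have := (List.suffix_of_suffix_length_le h h' (by simp)).eq_of_length (by simp)
  simpa using this

variable {M θ}

theorem mem_support_iteration_succ {T : Tree X A} {k : ℕ} {p : List (A × X)} {x : X}
    {r : ℝ × Tree X A} (hr : r ∈ (iteration M θ T (k + 1) p x).support) :
    ∃ a ∈ (T.choose θ p).support, ∃ y ∈ (M.step x a).support,
      ∃ r' ∈ (descend M θ T k p a y).support,
        r = (M.cost x + r'.1, r'.2.record p a (M.cost x + r'.1)) := by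
  rw [iteration_succ, PMF.mem_support_bind_iff] at hr
  obtain ⟨a, ha, hr⟩ := hr
  rw [PMF.mem_support_bind_iff] at hr
  obtain ⟨y, hy, hr⟩ := hr
  rw [PMF.mem_support_map_iff] at hr
  obtain ⟨r', hr', rfl⟩ := hr
  exact ⟨a, ha, y, hy, r', hr', rfl⟩

/-- Locality: an iteration writes only at nodes on its own path, all of which lie in the subtree
where it starts. -/
theorem iteration_eq_of_not_suffix {T : Tree X A} {k : ℕ} {p : List (A × X)} {x : X}
    {r : ℝ × Tree X A} (hr : r ∈ (iteration M θ T k p x).support) {q : List (A × X)}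
    (hq : ¬ p <:+ q) : r.2 q = T q := by
  induction k generalizing p x r with
  | zero =>
    rw [iteration, PMF.mem_support_pure_iff] at hr
    rw [hr]
  | succ k ih =>
    obtain ⟨a, -, y, -, r', hr', rfl⟩ := mem_support_iteration_succ hr
    refine (record_of_ne r'.2 (p := p) (q := q) (fun h => hq (by rw [h])) _ _).trans ?_
    rw [descend] at hr'
    split_ifs at hr' with h0
    · obtain ⟨g, -, rfl⟩ := (PMF.mem_support_map_iff _ _ _).1 hr'
      rfl
    · exact ih hr' fun h => hq ((List.suffix_cons _ _).trans h)

theorem descend_eq_of_not_suffix {T : Tree X A} {k : ℕ} {p : List (A × X)} {a : A} {y : X}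
    {r : ℝ × Tree X A} (hr : r ∈ (descend M θ T k p a y).support) {q : List (A × X)}
    (hq : ¬ ((a, y) :: p) <:+ q) : r.2 q = T q := by
  rw [descend] at hr
  split_ifs at hr with h0
  · obtain ⟨g, -, rfl⟩ := (PMF.mem_support_map_iff _ _ _).1 hr
    rfl
  · exact iteration_eq_of_not_suffix hr hq

theorem descend_eq_of_untried {T : Tree X A} {k : ℕ} {p : List (A × X)} {a : A} {y : X}
    {r : ℝ × Tree X A} (hr : r ∈ (descend M θ T k p a y).support) (h0 : (T p a).1 = 0) :
    r.2 = T := by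
  rw [descend, if_pos h0] at hr
  obtain ⟨g, -, rfl⟩ := (PMF.mem_support_map_iff _ _ _).1 hr
  rfl

theorem descend_of_tried {T : Tree X A} {k : ℕ} {p : List (A × X)} {a : A} {y : X}
    {r : ℝ × Tree X A} (hr : r ∈ (descend M θ T k p a y).support) (h0 : (T p a).1 ≠ 0) :
    r ∈ (iteration M θ T k ((a, y) :: p) y).support := by
  rwa [descend, if_neg h0] at hr

/-- With no steps left, rollout and descent give the same return. So just above the leaves the first
play of an action needs no correction. -/
theorem descend_zero_fst {T : Tree X A} {p : List (A × X)} {a : A} {y : X}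
    {r : ℝ × Tree X A} (hr : r ∈ (descend M θ T 0 p a y).support) : r.1 = M.cost y := by
  rw [descend] at hr
  split_ifs at hr with h0
  · obtain ⟨g, hg, rfl⟩ := (PMF.mem_support_map_iff _ _ _).1 hr
    rwa [rolloutReturn, PMF.mem_support_pure_iff] at hg
  · rw [iteration, PMF.mem_support_pure_iff] at hr
    rw [hr]

theorem visits_total_iteration_succ {T : Tree X A} {k : ℕ} {p : List (A × X)} {x : X}
    {r : ℝ × Tree X A} (hr : r ∈ (iteration M θ T (k + 1) p x).support) :
    r.2.visits p = T.visits p + 1 ∧ r.2.total p = T.total p + r.1 := by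
  obtain ⟨a, -, y, -, r', hr', rfl⟩ := mem_support_iteration_succ hr
  have h := descend_eq_of_not_suffix hr' (not_cons_suffix_self (a, y) p)
  exact ⟨by rw [visits_record, visits_congr h], by rw [total_record, total_congr h]⟩

variable (M) in
/-- `IsNode M x₀ K p x k`: in a search from root state `x₀` with `K` steps to go, `p` is a node at
state `x` with `k` steps to go. -/
inductive IsNode (x₀ : X) (K : ℕ) : List (A × X) → X → ℕ → Prop
  | root : IsNode x₀ K [] x₀ K
  | child {p x k a y} : IsNode x₀ K p x (k + 1) → y ∈ (M.step x a).support →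
      IsNode x₀ K ((a, y) :: p) y k

/-- An iteration from the root either leaves the subtree of a node unchanged, or acts on it as an
iteration from that node. -/
theorem IsNode.iteration_root {x₀ : X} {K : ℕ} {p : List (A × X)} {x : X} {k : ℕ}
    (hp : IsNode M x₀ K p x k) {T : Tree X A} {r : ℝ × Tree X A}
    (hr : r ∈ (iteration M θ T K [] x₀).support) :
    (∀ q, p <:+ q → r.2 q = T q) ∨
      ∃ r' ∈ (iteration M θ T k p x).support, ∀ q, p <:+ q → r.2 q = r'.2 q := by
  induction hp with
  | root => exact Or.inr ⟨r, hr, fun _ _ => rfl⟩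
  | @child p x k a y hp hy ih =>
    rcases ih with ih | ⟨r', hr', ih⟩
    · exact Or.inl fun q hq => ih q ((List.suffix_cons _ _).trans hq)
    · obtain ⟨a', -, y', -, r'', hr'', rfl⟩ := mem_support_iteration_succ hr'
      have hrec : ∀ q, ((a, y) :: p) <:+ q → r.2 q = r''.2 q := fun q hq => by
        rw [ih q ((List.suffix_cons _ _).trans hq)]
        exact record_of_ne r''.2 (by rintro rfl; exact not_cons_suffix_self _ _ hq) _ _
      by_cases h0 : (T p a').1 = 0
      · rw [descend_eq_of_untried hr'' h0] at hrec
        exact Or.inl hrec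
      · by_cases hc : (a', y') = (a, y)
        · obtain ⟨rfl, rfl⟩ := Prod.mk.inj hc
          exact Or.inr ⟨r'', descend_of_tried hr'' h0, hrec⟩
        · refine Or.inl fun q hq => ?_
          rw [hrec q hq]
          exact descend_eq_of_not_suffix hr'' fun h => hc (eq_of_cons_suffix h hq)

/-- A functional of the subtree of a node that is excessive for iterations from that node is
excessive for iterations from the root. -/
theorem IsNode.lexpect_le {x₀ : X} {K : ℕ} {p : List (A × X)} {x : X} {k : ℕ}
    (hp : IsNode M x₀ K p x k) {W : Tree X A → ℝ≥0∞}
    (hloc : ∀ T T' : Tree X A, (∀ q, p <:+ q → T' q = T q) → W T' = W T)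
    (hW : ∀ T, lexpect (iteration M θ T k p x) (fun r => W r.2) ≤ W T) (T : Tree X A) :
    lexpect (iteration M θ T K [] x₀) (fun r => W r.2) ≤ W T := by
  induction hp generalizing T with
  | root => exact hW T
  | @child p x k a y hp hy ih =>
    refine ih (fun T T' h => hloc T T' fun q hq => h q ((List.suffix_cons _ _).trans hq))
      (fun T => ?_) T
    rw [iteration_succ, lexpect_bind]
    refine GUMDP.lexpect_le fun a' _ => ?_
    rw [lexpect_bind]
    refine GUMDP.lexpect_le fun y' _ => ?_
    rw [lexpect_map]
    have hrec : ∀ (T' : Tree X A) (g : ℝ), W (T'.record p a' g) = W T' := fun T' g =>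
      hloc _ _ fun q hq => record_of_ne _ (by rintro rfl; exact not_cons_suffix_self _ _ hq) _ _
    simp only [hrec]
    -- Only a descent into this very child can touch its subtree, and there the hypothesis on W
    -- applies. In every other case W is unchanged.
    by_cases hc : (a', y') = (a, y) ∧ (T p a').1 ≠ 0
    · obtain ⟨rfl, rfl⟩ := Prod.mk.inj hc.1
      rw [descend, if_neg hc.2]
      exact hW T
    · refine GUMDP.lexpect_le fun r hr => (hloc _ _ fun q hq => ?_).le
      by_cases h0 : (T p a').1 = 0
      · rw [descend_eq_of_untried hr h0]
      · exact descend_eq_of_not_suffix hr fun h => hc ⟨eq_of_cons_suffix h hq, h0⟩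

/-- Functionals `Z` (centred sum) and `N` (count) of the subtree of node `p` at state `x`: an
iteration through `p` either leaves both unchanged, or increases `N` by one and `Z` by `h y`, where
`y` is the successor sampled for action `a`. -/
structure IsCentredSum (M : MDP X A) (θ : UCTParams X A) (k : ℕ) (p : List (A × X)) (x : X) (a : A)
    (h : X → ℝ) (Z : Tree X A → ℝ) (N : Tree X A → ℕ) : Prop where
  congr : ∀ T T' : Tree X A, (∀ q, p <:+ q → T' q = T q) → Z T' = Z T ∧ N T' = N T
  step : ∀ (T : Tree X A) (a' : A),
    (∀ y ∈ (M.step x a').support, ∀ r ∈ (descend M θ T k p a' y).support,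
      Z (r.2.record p a' (M.cost x + r.1)) = Z T ∧ N (r.2.record p a' (M.cost x + r.1)) = N T) ∨
    (a' = a ∧ ∀ y ∈ (M.step x a').support, ∀ r ∈ (descend M θ T k p a' y).support,
      Z (r.2.record p a' (M.cost x + r.1)) = Z T + h y ∧
        N (r.2.record p a' (M.cost x + r.1)) = N T + 1)

/-- The exponential supermartingale behind the strong law. Each relevant play multiplies it by
exp(λh(y) − λ²B²), whose mean is at most 1 by `expect_exp_le`. The rest of the iteration may depend
on y in any way, because the increments of Z and N depend on y alone. -/
theorem IsCentredSum.excessive {x₀ : X} {K : ℕ} {p : List (A × X)} {x : X} {k : ℕ} {a : A}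
    {h : X → ℝ} {Z : Tree X A → ℝ} {N : Tree X A → ℕ} (hZ : IsCentredSum M θ k p x a h Z N)
    (hp : IsNode M x₀ K p x (k + 1)) (hfin : (M.step x a).support.Finite)
    (h0 : expect (M.step x a) h = 0) {B lam : ℝ} (hB : ∀ y ∈ (M.step x a).support, |h y| ≤ B)
    (hl : |lam| * B ≤ 1) (T : Tree X A) :
    lexpect (iteration M θ T K [] x₀)
        (fun r => ENNReal.ofReal (Real.exp (lam * Z r.2 - lam ^ 2 * B ^ 2 * N r.2)))
      ≤ ENNReal.ofReal (Real.exp (lam * Z T - lam ^ 2 * B ^ 2 * N T)) := by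
  refine hp.lexpect_le
    (W := fun T => ENNReal.ofReal (Real.exp (lam * Z T - lam ^ 2 * B ^ 2 * N T)))
    (fun T T' hT => by simp only [hZ.congr T T' hT]) (fun T => ?_) T
  rw [iteration_succ, lexpect_bind]
  refine GUMDP.lexpect_le fun a' _ => ?_
  rw [lexpect_bind]
  simp only [lexpect_map]
  rcases hZ.step T a' with h1 | ⟨rfl, h1⟩
  · exact GUMDP.lexpect_le fun y hy => GUMDP.lexpect_le fun r hr => by
      rw [(h1 y hy r hr).1, (h1 y hy r hr).2]
  · set w := Real.exp (lam * Z T - lam ^ 2 * B ^ 2 * N T) with hw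
    set c := Real.exp (-(lam ^ 2 * B ^ 2)) with hc
    calc _ ≤ lexpect (M.step x a') (fun y => ENNReal.ofReal (w * c * Real.exp (lam * h y))) := by
          refine lexpect_mono_support fun y hy => GUMDP.lexpect_le fun r hr => ?_
          rw [(h1 y hy r hr).1, (h1 y hy r hr).2, hw, hc, ← Real.exp_add, ← Real.exp_add]
          refine ENNReal.ofReal_le_ofReal (Real.exp_le_exp.2 (le_of_eq ?_))
          push_cast; ring
      _ = ENNReal.ofReal (w * c * expect (M.step x a') (fun y => Real.exp (lam * h y))) := by
          rw [lexpect_ofReal hfin fun y => by positivity, expect_eq_sum hfin, expect_eq_sum hfin,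
            Finset.mul_sum]
          congr 1
          exact Finset.sum_congr rfl fun y _ => by ring
      _ ≤ ENNReal.ofReal (w * c * Real.exp (lam ^ 2 * B ^ 2)) := by
          refine ENNReal.ofReal_le_ofReal (mul_le_mul_of_nonneg_left ?_ (by positivity))
          exact expect_exp_le hfin h0 hB hl
      _ = ENNReal.ofReal w := by
          rw [mul_assoc, hc, ← Real.exp_add, neg_add_cancel, Real.exp_zero, mul_one]

end Iteration

end GUMDP

namespace GUMDP

open scoped ENNReal

/-! ### Consistency of the tree search -/

section Consistency

variable {X A : Type*} [Fintype A] {M : MDP X A} {θ : UCTParams X A}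

namespace MDP

variable (M)

/-- Value function of dynamic programming with `k` steps to go. -/
noncomputable def dpV : ℕ → X → ℝ
  | 0, x => M.cost x
  | k + 1, x => ⨅ a, M.cost x + expect (M.step x a) (dpV k)

/-- Action values of dynamic programming, with `k` steps to go after the action. -/
noncomputable def dpQ (k : ℕ) (x : X) (a : A) : ℝ := M.cost x + expect (M.step x a) (M.dpV k)

end MDP

theorem tendsto_div_zero_of_forall_le {z : ℕ → ℝ} {N : ℕ → ℕ}
    (h : ∀ ε > 0, ∃ c, ∀ n, |z n| ≤ c + ε * N n) (hN : Tendsto N atTop atTop) :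
    Tendsto (fun n => z n / N n) atTop (𝓝 0) := by
  rw [Metric.tendsto_nhds]
  intro ε hε
  obtain ⟨c, hc⟩ := h (ε / 2) (half_pos hε)
  have h1 := (tendsto_natCast_atTop_atTop (R := ℝ)).comp hN
  filter_upwards [hN.eventually_ge_atTop 1, h1.eventually_gt_atTop (c / (ε / 2))] with n hn hn'
  have hpos : (0 : ℝ) < N n := by exact_mod_cast hn
  rw [Real.dist_eq, sub_zero, abs_div, abs_of_pos hpos, div_lt_iff₀ hpos]
  have h2 : c < N n * (ε / 2) := (div_lt_iff₀ (half_pos hε)).1 hn'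
  linarith [hc n]

/-- A random sequence of trees that evolves like the tree search. -/
structure IsSearchRun {Ω : Type*} [MeasurableSpace Ω] (μ : Measure Ω) (M : MDP X A)
    (θ : UCTParams X A) (x₀ : X) (K : ℕ) (τ : ℕ → Ω → Tree X A) : Prop where
  run : ∀ᵐ ω ∂μ, τ 0 ω = (fun _ _ => (0, 0)) ∧
    ∀ n, ∃ r ∈ (iteration M θ (τ n ω) K [] x₀).support, r.2 = τ (n + 1) ω
  bounded : ∀ W : Tree X A → ℝ≥0∞, W (fun _ _ => (0, 0)) ≠ ∞ →
    (∀ T, lexpect (iteration M θ T K [] x₀) (fun r => W r.2) ≤ W T) →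
      ∀ᵐ ω ∂μ, ∃ c : ℕ, ∀ n, W (τ n ω) ≤ c

theorem le_of_ofReal_exp_le {u : ℝ} {c : ℕ} (h : ENNReal.ofReal (Real.exp u) ≤ c) : u ≤ c := by
  have h1 : Real.exp u ≤ c := by
    rw [← ENNReal.ofReal_natCast] at h
    exact (ENNReal.ofReal_le_ofReal_iff (by positivity)).1 h
  linarith [Real.add_one_le_exp u]

/-- Strong law of large numbers for centred sums along the search. -/
theorem IsSearchRun.ae_tendsto_div {Ω : Type*} [MeasurableSpace Ω] {μ : Measure Ω} {x₀ : X}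
    {K : ℕ} {τ : ℕ → Ω → Tree X A} (hτ : IsSearchRun μ M θ x₀ K τ)
    {p : List (A × X)} {x : X} {k : ℕ} {a : A} {h : X → ℝ} {Z : Tree X A → ℝ} {N : Tree X A → ℕ}
    (hZ : IsCentredSum M θ k p x a h Z N) (hp : IsNode M x₀ K p x (k + 1))
    (hfin : (M.step x a).support.Finite) (h0 : expect (M.step x a) h = 0) :
    ∀ᵐ ω ∂μ, Tendsto (fun n => N (τ n ω)) atTop atTop →
      Tendsto (fun n => Z (τ n ω) / N (τ n ω)) atTop (𝓝 0) := by
  obtain ⟨B, hB0, hB⟩ : ∃ B, 0 ≤ B ∧ ∀ y ∈ (M.step x a).support, |h y| ≤ B :=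
    ⟨∑ y ∈ hfin.toFinset, |h y|, Finset.sum_nonneg fun _ _ => abs_nonneg _, fun y hy =>
      Finset.single_le_sum (f := fun y => |h y|) (fun _ _ => abs_nonneg _)
        (hfin.mem_toFinset.2 hy)⟩
  -- Parameters λ tending to zero with l j · B ≤ 1. Boundedness of the supermartingales for ±l j
  -- gives |Z| ≤ const + l j · B² · N, and l j · B² is arbitrarily small. The summand 1 in B + 1
  -- covers B = 0.
  set l : ℕ → ℝ := fun j => 1 / ((j + 1) * (B + 1))
  have hl : ∀ j, 0 < l j := fun j => by positivity
  have hlB : ∀ j, l j * B ≤ 1 := by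
    intro j
    rw [div_mul_eq_mul_div, one_mul, div_le_one (by positivity)]
    nlinarith [Nat.cast_nonneg (α := ℝ) j]
  have hae : ∀ s : ℝ, |s| = 1 → ∀ j : ℕ, ∀ᵐ ω ∂μ, ∃ c : ℕ, ∀ n,
      s * l j * Z (τ n ω) - (s * l j) ^ 2 * B ^ 2 * N (τ n ω) ≤ c := by
    intro s hs j
    have := hτ.bounded (fun T => ENNReal.ofReal (Real.exp (s * l j * Z T
      - (s * l j) ^ 2 * B ^ 2 * N T))) ENNReal.ofReal_ne_top
      (hZ.excessive hp hfin h0 hB (by rw [abs_mul, hs, one_mul, abs_of_pos (hl j)]; exact hlB j))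
    filter_upwards [this] with ω ⟨c, hc⟩
    exact ⟨c, fun n => le_of_ofReal_exp_le (hc n)⟩
  filter_upwards [ae_all_iff.2 (hae 1 (by simp)), ae_all_iff.2 (hae (-1) (by simp))]
    with ω h1 h2 hN
  refine tendsto_div_zero_of_forall_le (fun ε hε => ?_) hN
  obtain ⟨j, hj⟩ := exists_nat_gt (B / ε)
  obtain ⟨c1, h1⟩ := h1 j
  obtain ⟨c2, h2⟩ := h2 j
  refine ⟨(c1 + c2) / l j, fun n => ?_⟩
  have hle : l j * B ^ 2 ≤ ε := by
    rw [div_mul_eq_mul_div, one_mul, div_le_iff₀ (by positivity)]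
    have : B ≤ ε * (j + 1) := by
      rw [div_lt_iff₀ hε] at hj
      nlinarith
    nlinarith [mul_le_mul this (show B ≤ B + 1 by linarith) hB0 (by positivity)]
  have hle' : l j * B ^ 2 * N (τ n ω) ≤ ε * N (τ n ω) :=
    mul_le_mul_of_nonneg_right hle (by positivity)
  have h3 : |Z (τ n ω)| * l j ≤ c1 + c2 + l j * (l j * B ^ 2 * N (τ n ω)) := by
    rcases abs_cases (Z (τ n ω)) with ⟨h4, -⟩ | ⟨h4, -⟩ <;> rw [h4]
    · have := h1 n
      have : (0 : ℝ) ≤ c2 := by positivity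
      nlinarith
    · have := h2 n
      have : (0 : ℝ) ≤ c1 := by positivity
      nlinarith
  have h5 : |Z (τ n ω)| ≤ (c1 + c2) / l j + l j * B ^ 2 * N (τ n ω) := by
    rw [div_add' _ _ _ (hl j).ne', le_div_iff₀ (hl j)]
    linarith
  linarith

/-- Above the last step, the returns of an action are a centred sum around its value. -/
theorem isCentredSum_last (p : List (A × X)) (x : X) (a : A) (e : ℝ) :
    IsCentredSum M θ 0 p x a (fun y => M.cost y - e)
      (fun T => (T p a).2 - (T p a).1 * (M.cost x + e)) (fun T => (T p a).1) where
  congr T T' h := by simp only [h p List.suffix_rfl, and_self]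
  step T a' := by
    by_cases ha : a' = a
    · subst ha
      refine Or.inr ⟨rfl, fun y _ r hr => ?_⟩
      rw [record_self, descend_eq_of_not_suffix hr (not_cons_suffix_self _ _), descend_zero_fst hr]
      refine ⟨?_, rfl⟩
      push_cast; ring
    · refine Or.inl fun y _ r hr => ?_
      rw [record_of_ne_action _ _ (Ne.symm ha),
        descend_eq_of_not_suffix hr (not_cons_suffix_self _ _)]
      exact ⟨rfl, rfl⟩

omit [Fintype A] in
theorem cons_ne_self (z : A × X) (p : List (A × X)) : z :: p ≠ p := fun h => by
  simpa using congrArg List.length h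

/-- The visits of the successors of an action, weighted by `V`, are a centred sum. -/
theorem isCentredSum_inner (k : ℕ) (p : List (A × X)) (x : X) (a : A)
    (hfin : (M.step x a).support.Finite) (V : X → ℝ) (e : ℝ) :
    IsCentredSum M θ (k + 1) p x a (fun y => V y - e)
      (fun T => ∑ y ∈ hfin.toFinset, V y * T.visits ((a, y) :: p) - ((T p a).1 - 1 : ℕ) * e)
      (fun T => (T p a).1 - 1) where
  congr T T' h := by
    have : ∀ y, T'.visits ((a, y) :: p) = T.visits ((a, y) :: p) := fun y =>
      visits_congr (h _ (List.suffix_cons _ _))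
    simp only [h p List.suffix_rfl, this, and_self]
  step T a' := by
    classical
    have hv : ∀ (T' : Tree X A) (g : ℝ) y, (T'.record p a' g).visits ((a, y) :: p)
        = T'.visits ((a, y) :: p) := fun T' g y => visits_congr (record_of_ne _ (cons_ne_self _ _) _ _)
    simp only [hv]
    by_cases ha : a' = a
    · subst ha
      -- The first play of an action is evaluated by a rollout and visits no child. Truncated
      -- subtraction matches this: N − 1 equals 0 both before and after it.
      by_cases h0 : (T p a').1 = 0
      · refine Or.inl fun y _ r hr => ?_
        rw [record_self, descend_eq_of_untried hr h0, h0]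
        exact ⟨rfl, rfl⟩
      · refine Or.inr ⟨rfl, fun y hy r hr => ?_⟩
        have hvis : ∀ y', (r.2.visits ((a', y') :: p) : ℝ)
            = T.visits ((a', y') :: p) + if y' = y then 1 else 0 := by
          intro y'
          by_cases hyy : y' = y
          · subst hyy
            rw [(visits_total_iteration_succ (descend_of_tried hr h0)).1]
            simp
          · rw [visits_congr (descend_eq_of_not_suffix hr fun hs => hyy ?_)]
            · simp [hyy]
            · have := eq_of_cons_suffix hs List.suffix_rfl
              exact (Prod.mk.inj this).2.symm
        have hmem : y ∈ hfin.toFinset := hfin.mem_toFinset.2 hy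
        rw [record_self, descend_eq_of_not_suffix hr (not_cons_suffix_self _ _)]
        have hc : (T p a').1 + 1 - 1 = ((T p a').1 - 1) + 1 := by omega
        refine ⟨?_, hc⟩
        simp only [hvis, mul_add, Finset.sum_add_distrib, hc, mul_ite, mul_one, mul_zero,
          Finset.sum_ite_eq', hmem, if_true]
        push_cast; ring
    · refine Or.inl fun y _ r hr => ?_
      rw [record_of_ne_action _ _ (Ne.symm ha),
        descend_eq_of_not_suffix hr (not_cons_suffix_self _ _)]
      have : ∀ y', r.2.visits ((a, y') :: p) = T.visits ((a, y') :: p) := fun y' =>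
        visits_congr (descend_eq_of_not_suffix hr fun hs => ha
          (Prod.mk.inj (eq_of_cons_suffix hs List.suffix_rfl)).1)
      simp only [this, and_self]

theorem choose_spec [Nonempty A] {T : Tree X A} {p : List (A × X)} {a : A}
    (ha : a ∈ (T.choose θ p).support) :
    (T p a).1 = 0 ∨ ∀ b, (T p b).1 ≠ 0 ∧ T.index θ.Cp p a ≤ T.index θ.Cp p b := by
  rw [Tree.choose] at ha
  split_ifs at ha with hne
  · have := θ.pick_mem _ hne a ha
    simp only [Tree.untried, Finset.mem_filter, Finset.mem_univ, true_and] at this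
    exact Or.inl this
  · have hg : (T.greedy θ.Cp p).Nonempty := by
      obtain ⟨b, hb⟩ := Finite.exists_min fun b => T.index θ.Cp p b
      exact ⟨b, by simpa [Tree.greedy] using hb⟩
    have := θ.pick_mem _ hg a ha
    simp only [Tree.greedy, Finset.mem_filter, Finset.mem_univ, true_and] at this
    refine Or.inr fun b => ⟨fun hb => hne ⟨b, ?_⟩, this b⟩
    simpa [Tree.untried] using hb

/-! ### Statistics of a node along one path of the search -/

section Run

variable {x₀ : X} {K : ℕ} {T : ℕ → Tree X A}
  (hT : ∀ n, ∃ r ∈ (iteration M θ (T n) K [] x₀).support, r.2 = T (n + 1))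
include hT

/-- A root iteration either bypasses the node or plays there exactly one action chosen by
`Tree.choose`. Hence every decision node is a bandit in the deterministic sense, idle while the
search is elsewhere. -/
theorem IsNode.isIndexRun [Nonempty A] {p : List (A × X)} {x : X} {k : ℕ}
    (hp : IsNode M x₀ K p x (k + 1)) :
    IsIndexRun θ.Cp (fun n a => (T n p a).1) (fun n a => (T n p a).2) := by
  have key : ∀ n, T (n + 1) p = T n p ∨ ∃ a ∈ ((T n).choose θ p).support,
      (T (n + 1) p a).1 = (T n p a).1 + 1 ∧ ∀ b ≠ a, T (n + 1) p b = T n p b := by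
    intro n
    obtain ⟨r, hr, hrT⟩ := hT n
    rcases hp.iteration_root hr with h | ⟨r', hr', h⟩
    · exact Or.inl (by rw [← hrT, h p List.suffix_rfl])
    · obtain ⟨a, ha, y, -, r'', hr'', rfl⟩ := mem_support_iteration_succ hr'
      have h' : T (n + 1) p = r''.2.record p a (M.cost x + r''.1) p := by
        rw [← hrT, h p List.suffix_rfl]
      have h2 := descend_eq_of_not_suffix hr'' (not_cons_suffix_self (a, y) p)
      refine Or.inr ⟨a, ha, ?_, fun b hb => ?_⟩
      · rw [h', record_self, h2]
      · rw [h', record_of_ne_action _ _ hb, h2]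
  refine ⟨fun n => ?_, fun n a h => ?_⟩
  · rcases key n with h | ⟨a, ha, h1, h2⟩
    · exact Or.inl (by simp only [h])
    · exact Or.inr ⟨a, h1, fun b hb => by simp only [h2 b hb], choose_spec ha⟩
  · rcases key n with h1 | ⟨b, hb, h1, h2⟩
    · rw [h1]
    · by_cases hab : a = b
      · subst hab; omega
      · rw [h2 a hab]

/-- Bookkeeping between an action above an inner node and its successors. -/
theorem IsNode.inner_step {p : List (A × X)} {x : X} {k : ℕ}
    (hp : IsNode M x₀ K p x (k + 1 + 1)) {a : A} (hfin : (M.step x a).support.Finite) (n : ℕ) :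
    ((T n p a).1 - 1 = ∑ y ∈ hfin.toFinset, (T n).visits ((a, y) :: p) →
      (T (n + 1) p a).1 - 1 = ∑ y ∈ hfin.toFinset, (T (n + 1)).visits ((a, y) :: p)) ∧
    ((T n p a).1 ≠ 0 → (T (n + 1) p a).2 - ∑ y ∈ hfin.toFinset,
        (M.cost x * (T (n + 1)).visits ((a, y) :: p) + (T (n + 1)).total ((a, y) :: p))
      = (T n p a).2 - ∑ y ∈ hfin.toFinset,
        (M.cost x * (T n).visits ((a, y) :: p) + (T n).total ((a, y) :: p))) := by
  classical
  obtain ⟨r, hr, hrT⟩ := hT n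
  rw [← hrT]
  -- Disposes at once of iterations that bypass p or play another action; below, these cases
  -- contradict the negation.
  by_cases hsame : r.2 p a = T n p a ∧ ∀ y, r.2 ((a, y) :: p) = T n ((a, y) :: p)
  · have hv : ∀ y, r.2.visits ((a, y) :: p) = (T n).visits ((a, y) :: p) := fun y =>
      visits_congr (hsame.2 y)
    have ht : ∀ y, r.2.total ((a, y) :: p) = (T n).total ((a, y) :: p) := fun y =>
      total_congr (hsame.2 y)
    simp only [hsame.1, hv, ht]
    exact ⟨id, fun _ => trivial⟩
  rcases hp.iteration_root hr with h | ⟨r', hr', h⟩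
  · exact absurd ⟨by rw [h p List.suffix_rfl], fun y => h _ (List.suffix_cons _ _)⟩ hsame
  · obtain ⟨a', -, y', hy', r'', hr'', rfl⟩ := mem_support_iteration_succ hr'
    have hself : r.2 p = r''.2.record p a' (M.cost x + r''.1) p := h p List.suffix_rfl
    have hchild : ∀ y, r.2 ((a, y) :: p) = r''.2 ((a, y) :: p) := fun y => by
      rw [h _ (List.suffix_cons _ _)]
      exact record_of_ne _ (cons_ne_self _ _) _ _
    have hp2 := descend_eq_of_not_suffix hr'' (not_cons_suffix_self (a', y') p)
    by_cases ha : a' = a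
    · subst ha
      by_cases h0 : (T n p a').1 = 0
      · have hv : ∀ y, r.2.visits ((a', y) :: p) = (T n).visits ((a', y) :: p) := fun y =>
          visits_congr (by rw [hchild, descend_eq_of_untried hr'' h0])
        refine ⟨fun h1 => ?_, fun h1 => absurd h0 h1⟩
        simp only [hv, ← h1, hself, record_self, hp2, h0]
      · have hit := visits_total_iteration_succ (descend_of_tried hr'' h0)
        have hne : ∀ y, y ≠ y' → r''.2 ((a', y) :: p) = T n ((a', y) :: p) := fun y hy =>
          descend_eq_of_not_suffix hr'' fun hs => hy
            (Prod.mk.inj (eq_of_cons_suffix hs List.suffix_rfl)).2.symm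
        have hv : ∀ y, r.2.visits ((a', y) :: p)
            = (T n).visits ((a', y) :: p) + if y = y' then 1 else 0 := by
          intro y
          rw [visits_congr (hchild y)]
          by_cases hy : y = y'
          · subst hy; simp [hit.1]
          · simp [hy, visits_congr (hne y hy)]
        have ht : ∀ y, r.2.total ((a', y) :: p)
            = (T n).total ((a', y) :: p) + if y = y' then r''.1 else 0 := by
          intro y
          rw [total_congr (hchild y)]
          by_cases hy : y = y'
          · subst hy; simp [hit.2]
          · simp [hy, total_congr (hne y hy)]
        have hmem : y' ∈ hfin.toFinset := hfin.mem_toFinset.2 hy'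
        have hrec : r.2 p a' = ((T n p a').1 + 1, (T n p a').2 + (M.cost x + r''.1)) := by
          rw [hself, record_self, hp2]
        constructor
        · intro h1
          simp only [hv, Finset.sum_add_distrib, Finset.sum_ite_eq', hmem, if_true, hrec, ← h1]
          omega
        · intro _
          simp only [hv, ht, hrec, Nat.cast_add, Nat.cast_ite, Nat.cast_one, Nat.cast_zero,
            mul_add, mul_ite, mul_one, mul_zero, Finset.sum_add_distrib, Finset.sum_ite_eq', hmem,
            if_true]
          ring
    · refine absurd ⟨by rw [hself, record_of_ne_action _ _ (Ne.symm ha), hp2], fun y => ?_⟩ hsame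
      rw [hchild]
      exact descend_eq_of_not_suffix hr'' fun hs => ha
        (Prod.mk.inj (eq_of_cons_suffix hs List.suffix_rfl)).1

end Run

/-- Convergence of an average return that is assembled from the averages at the successors. -/
theorem tendsto_average {Y : Type*} {F : Finset Y} {N : ℕ → ℕ} {S : ℕ → ℝ} {v : Y → ℕ → ℕ}
    {t : Y → ℕ → ℝ} {V : Y → ℝ} {c e D : ℝ} (hN : Tendsto N atTop atTop)
    (h1 : ∀ n, N n - 1 = ∑ y ∈ F, v y n)
    (h2 : ∀ᶠ n in atTop, S n - ∑ y ∈ F, (c * v y n + t y n) = D)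
    (h3 : ∀ y ∈ F, Tendsto (fun n => (t y n - V y * v y n) / N n) atTop (𝓝 0))
    (h4 : Tendsto (fun n => (∑ y ∈ F, V y * v y n - (N n - 1 : ℕ) * e) / ((N n - 1 : ℕ) : ℝ))
      atTop (𝓝 0)) :
    Tendsto (fun n => S n / N n) atTop (𝓝 (c + e)) := by
  have hN' : Tendsto (fun n => (N n : ℝ)) atTop atTop := tendsto_natCast_atTop_atTop.comp hN
  have hD := hN'.const_div_atTop D
  have h1' := hN'.const_div_atTop 1
  have hr : Tendsto (fun n => ((N n - 1 : ℕ) : ℝ) / N n) atTop (𝓝 1) := by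
    have : Tendsto (fun n => 1 - 1 / (N n : ℝ)) atTop (𝓝 1) := by simpa using h1'.const_sub 1
    refine this.congr' ?_
    filter_upwards [hN.eventually_ge_atTop 1] with n hn
    have : (N n : ℝ) ≠ 0 := by exact_mod_cast (Nat.one_le_iff_ne_zero.1 hn)
    rw [Nat.cast_sub hn]
    field_simp
    simp
  have hsum := tendsto_finsetSum F h3
  -- S/N splits into D/N, the immediate cost c(N−1)/N, the errors of the successors' averages, the
  -- sampling error of the transitions, and e(N−1)/N.
  have hlim := (((hD.add (hr.const_mul c)).add hsum).add (h4.mul hr)).add (hr.const_mul e)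
  simp only [Finset.sum_const_zero, zero_add, mul_one, add_zero] at hlim
  refine hlim.congr' ?_
  filter_upwards [hN.eventually_ge_atTop 2, h2] with n hn hD'
  have hN0 : (N n : ℝ) ≠ 0 := by
    have : N n ≠ 0 := by omega
    exact_mod_cast this
  have hN1 : ((N n - 1 : ℕ) : ℝ) ≠ 0 := by
    have : N n - 1 ≠ 0 := by omega
    exact_mod_cast this
  have hv : ((N n - 1 : ℕ) : ℝ) = ∑ y ∈ F, (v y n : ℝ) := by rw [h1, Nat.cast_sum]
  have hS : S n = D + c * ((N n - 1 : ℕ) : ℝ) + ∑ y ∈ F, t y n := by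
    rw [← hD', hv, Finset.sum_add_distrib, Finset.mul_sum]; ring
  rw [← Finset.sum_div, Finset.sum_sub_distrib, div_mul_div_cancel₀ hN1, hS]
  field_simp
  ring

/-- Avoids showing that each successor is visited infinitely often. If its visits stay bounded, the
numerator is eventually constant while R → ∞; otherwise the average converges and the visits are at
most R. -/
theorem IsIndexRun.tendsto_sub_div {Cp : ℝ} {N : ℕ → A → ℕ} {S : ℕ → A → ℝ}
    (h : IsIndexRun Cp N S) {V : ℝ} {R : ℕ → ℕ} (hR : Tendsto R atTop atTop)
    (hle : ∀ n, ∑ a, N n a ≤ R n)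
    (hV : Tendsto (fun n => ∑ a, N n a) atTop atTop →
      Tendsto (fun n => (∑ a, S n a) / ((∑ a, N n a : ℕ) : ℝ)) atTop (𝓝 V)) :
    Tendsto (fun n => ((∑ a, S n a) - V * ((∑ a, N n a : ℕ) : ℝ)) / R n) atTop (𝓝 0) := by
  have hR' : Tendsto (fun n => (R n : ℝ)) atTop atTop := tendsto_natCast_atTop_atTop.comp hR
  by_cases hb : ∃ m, ∀ n, ∑ a, N n a ≤ m
  · obtain ⟨m, hm⟩ := hb
    have hc : ∀ a, ∃ n₀, ∀ n ≥ n₀, N n a = N n₀ a := fun a =>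
      eventually_const_of_bounded (h.monotone a) (m := m) fun n =>
        (Finset.single_le_sum (f := fun a => N n a) (fun _ _ => Nat.zero_le _)
          (Finset.mem_univ a)).trans (hm n)
    choose n₀ h₀ using hc
    have hS : ∀ᶠ n in atTop, ∀ a, N n a = N (n₀ a) a ∧ S n a = S (n₀ a) a :=
      eventually_all.2 fun a => (eventually_ge_atTop (n₀ a)).mono fun n hn =>
        ⟨h₀ a n hn, h.sum_const (h₀ a) n hn⟩
    refine (hR'.const_div_atTop ((∑ a, S (n₀ a) a)
      - V * ((∑ a, N (n₀ a) a : ℕ) : ℝ))).congr' ?_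
    filter_upwards [hS] with n hn
    rw [Finset.sum_congr rfl fun a _ => (hn a).2, Finset.sum_congr rfl fun a _ => (hn a).1]
  · push Not at hb
    have hN : Tendsto (fun n => ∑ a, N n a) atTop atTop :=
      tendsto_atTop_atTop_of_monotone
        (fun i j hij => Finset.sum_le_sum fun a _ => h.monotone a hij)
        fun m => (hb m).imp fun _ hn => hn.le
    have hlim := (hV hN).sub_const V
    rw [sub_self] at hlim
    have := bdd_le_mul_tendsto_zero' (f := fun n => ((∑ a, N n a : ℕ) : ℝ) / R n) 1
      (Eventually.of_forall fun n => by
        rw [abs_of_nonneg (by positivity)]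
        exact div_le_one_of_le₀ (by exact_mod_cast hle n) (by positivity)) hlim
    refine this.congr' ?_
    filter_upwards [hN.eventually_ge_atTop 1] with n hn
    have : ((∑ a, N n a : ℕ) : ℝ) ≠ 0 := by exact_mod_cast (Nat.one_le_iff_ne_zero.1 hn)
    field_simp

theorem expect_sub_const {Z : Type*} {p : PMF Z} (hp : p.support.Finite) (g : Z → ℝ) :
    expect p (fun z => g z - expect p g) = 0 := by
  rw [expect_eq_sum hp (fun z => g z - expect p g)]
  simp only [mul_sub, Finset.sum_sub_distrib]
  rw [← Finset.sum_mul, sum_toReal_eq_one hp, ← expect_eq_sum hp, one_mul, sub_self]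

/-- At every node that is visited infinitely often, the average returns converge to the values of
dynamic programming. -/
theorem IsSearchRun.ae_tendsto_mean [Nonempty A] {Ω : Type*} [MeasurableSpace Ω]
    {μ : Measure Ω} {x₀ : X} {K : ℕ} {τ : ℕ → Ω → Tree X A}
    (hτ : IsSearchRun μ M θ x₀ K τ) (hfin : ∀ x a, (M.step x a).support.Finite) (k : ℕ)
    {p : List (A × X)} {x : X} (hp : IsNode M x₀ K p x (k + 1)) :
    ∀ᵐ ω ∂μ, Tendsto (fun n => (τ n ω).visits p) atTop atTop →
      (∀ a, Tendsto (fun n => (τ n ω).mean p a) atTop (𝓝 (M.dpQ k x a))) ∧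
      Tendsto (fun n => (τ n ω).total p / (τ n ω).visits p) atTop (𝓝 (M.dpV (k + 1) x)) := by
  induction k generalizing p x with
  | zero =>
    have hsl := ae_all_iff.2 fun a => hτ.ae_tendsto_div
      (isCentredSum_last p x a (expect (M.step x a) M.cost)) hp (hfin x a)
      (expect_sub_const (hfin x a) M.cost)
    filter_upwards [hτ.run, hsl] with ω hrun hsl hN
    have hidx := hp.isIndexRun hrun.2
    have hq : ∀ a, Tendsto (fun n => (τ n ω p a).1) atTop atTop →
        Tendsto (fun n => (τ n ω p a).2 / (τ n ω p a).1) atTop (𝓝 (M.dpQ 0 x a)) := by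
      intro a ha
      have := (hsl a ha).add_const (M.dpQ 0 x a)
      rw [zero_add] at this
      refine this.congr' ?_
      filter_upwards [ha.eventually_ge_atTop 1] with n hn
      have : ((τ n ω p a).1 : ℝ) ≠ 0 := by exact_mod_cast (Nat.one_le_iff_ne_zero.1 hn)
      have hQ : M.dpQ 0 x a = M.cost x + expect (M.step x a) M.cost := rfl
      rw [hQ]
      field_simp
      ring
    exact ⟨fun a => hq a (hidx.tendsto_count hq hN θ.Cp_pos a),
      hidx.tendsto_total hq hN θ.Cp_pos⟩
  | succ k ih =>
    have hsl := ae_all_iff.2 fun a => hτ.ae_tendsto_div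
      (isCentredSum_inner k p x a (hfin x a) (M.dpV (k + 1))
        (expect (M.step x a) (M.dpV (k + 1)))) hp (hfin x a)
      (expect_sub_const (hfin x a) (M.dpV (k + 1)))
    have hch := ae_all_iff.2 fun a => (ae_ball_iff (hfin x a).countable).2
      fun y hy => ih (IsNode.child hp hy)
    filter_upwards [hτ.run, hsl, hch] with ω hrun hsl hch hN
    have hidx := hp.isIndexRun hrun.2
    have hq : ∀ a, Tendsto (fun n => (τ n ω p a).1) atTop atTop →
        Tendsto (fun n => (τ n ω p a).2 / (τ n ω p a).1) atTop (𝓝 (M.dpQ (k + 1) x a)) := by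
      intro a ha
      have hcount : ∀ n, (τ n ω p a).1 - 1
          = ∑ y ∈ (hfin x a).toFinset, (τ n ω).visits ((a, y) :: p) := by
        intro n
        induction n with
        | zero => rw [hrun.1]; simp [Tree.visits]
        | succ n ihn => exact (hp.inner_step hrun.2 (hfin x a) n).1 ihn
      -- From the first play on, the sum at the edge and the contributions of its successors grow by
      -- the same amounts. Their difference, due to the initial rollout, is a constant that averages
      -- out.
      obtain ⟨n₀, hn₀⟩ := eventually_atTop.1 (ha.eventually_ge_atTop 1)
      have hconst : ∀ n ≥ n₀, (τ n ω p a).2 - ∑ y ∈ (hfin x a).toFinset,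
            (M.cost x * (τ n ω).visits ((a, y) :: p) + (τ n ω).total ((a, y) :: p))
          = (τ n₀ ω p a).2 - ∑ y ∈ (hfin x a).toFinset,
            (M.cost x * (τ n₀ ω).visits ((a, y) :: p) + (τ n₀ ω).total ((a, y) :: p)) := by
        intro n hn
        induction n, hn using Nat.le_induction with
        | base => rfl
        | succ n hn ihn =>
          rw [(hp.inner_step hrun.2 (hfin x a) n).2 (Nat.one_le_iff_ne_zero.1 (hn₀ n hn)), ihn]
      refine tendsto_average ha hcount ((eventually_ge_atTop n₀).mono hconst) (fun y hy => ?_)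
        (hsl a ?_)
      · have hy' := (hfin x a).mem_toFinset.1 hy
        have hc := (IsNode.child hp hy').isIndexRun hrun.2
        refine hc.tendsto_sub_div ha (fun n => ?_) fun hN => (hch a y hy' hN).2
        calc (τ n ω).visits ((a, y) :: p)
            ≤ ∑ y ∈ (hfin x a).toFinset, (τ n ω).visits ((a, y) :: p) :=
              Finset.single_le_sum (f := fun y => (τ n ω).visits ((a, y) :: p))
                (fun _ _ => Nat.zero_le _) hy
          _ = (τ n ω p a).1 - 1 := (hcount n).symm
          _ ≤ _ := Nat.sub_le _ _
      · exact (tendsto_sub_atTop_nat 1).comp ha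
    exact ⟨fun a => hq a (hidx.tendsto_count hq hN θ.Cp_pos a),
      hidx.tendsto_total hq hN θ.Cp_pos⟩

theorem chainLaw_search (x₀ : X) (K n : ℕ) :
    chainLaw (fun _ _ => (0, 0)) (fun T => (iteration M θ T K [] x₀).map Prod.snd) n
      = search M θ K x₀ n := by
  induction n with
  | zero => rfl
  | succ n ih => rw [chainLaw, ih, search]

/-- The action returned by the search is optimal with probability tending to one. -/
theorem tendsto_uctAction [Nonempty A] (hfin : ∀ x a, (M.step x a).support.Finite) (k : ℕ)
    (x : X) : Tendsto (fun n => (uctAction M θ (k + 1) n x).toOuterMeasure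
      {a | ∀ b, M.dpQ k x a ≤ M.dpQ k x b}) atTop (𝓝 1) := by
  obtain ⟨m, μ, hlaw, hprob, hrun, hbdd⟩ := exists_chain (fun _ _ => (0, 0) : Tree X A)
    (fun T => (iteration M θ T (k + 1) [] x).map Prod.snd)
  have hτ : @IsSearchRun X A _ _ m μ M θ x (k + 1) (fun n ω => ω n) :=
    ⟨hrun.mono fun ω h => ⟨h.1, fun n => (PMF.mem_support_map_iff _ _ _).1 (h.2 n)⟩,
      fun W h0 hW => hbdd W h0 fun T => by
        have := hW T
        rwa [← lexpect_map] at this⟩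
  set O : Set A := {a | ∀ b, M.dpQ k x a ≤ M.dpQ k x b}
  -- Trees for which every possible outcome of the final pick is optimal. Nonemptiness is needed
  -- because `pick` is constrained only on nonempty sets.
  set G : Set (Tree X A) := {T | (T.best []).Nonempty ∧ ↑(T.best []) ⊆ O}
  have hG : ∀ᵐ ω ∂μ, ∀ᶠ n in atTop, ω n ∈ G := by
    filter_upwards [hτ.run, hτ.ae_tendsto_mean hfin k IsNode.root] with ω hrun hmean
    have hvis : ∀ n, Tree.visits (ω n) [] = n := by
      intro n
      induction n with
      | zero => rw [hrun.1]; simp [Tree.visits]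
      | succ n ih =>
        obtain ⟨r, hr, hr'⟩ := hrun.2 n
        rw [← hr', (visits_total_iteration_succ hr).1, ih]
    have hvis' : Tendsto (fun n => Tree.visits (ω n) []) atTop atTop := by
      simp only [hvis]
      exact tendsto_id
    obtain ⟨hmean, -⟩ := hmean hvis'
    have hidx := IsNode.root.isIndexRun hrun.2
    have hsep : ∀ᶠ n in atTop, ∀ a b, M.dpQ k x a < M.dpQ k x b →
        Tree.mean (ω n) [] a < Tree.mean (ω n) [] b := by
      refine eventually_all.2 fun a => eventually_all.2 fun b => ?_
      by_cases h : M.dpQ k x a < M.dpQ k x b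
      · exact ((hmean a).eventually_lt (hmean b) h).mono fun n hn _ => hn
      · exact Eventually.of_forall fun n h' => absurd h' h
    have hpos : ∀ᶠ n in atTop, ∀ a, (ω n [] a).1 ≠ 0 := by
      refine eventually_all.2 fun a => ?_
      have := hidx.tendsto_count (q := fun a => M.dpQ k x a) (fun a _ => hmean a)
        hvis' θ.Cp_pos a
      exact (this.eventually_ge_atTop 1).mono fun n hn => Nat.one_le_iff_ne_zero.1 hn
    filter_upwards [hsep, hpos] with n h1 h2
    refine ⟨?_, fun a ha b => ?_⟩
    · obtain ⟨b, hb⟩ := Finite.exists_min fun b => Tree.mean (ω n) [] b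
      refine ⟨b, ?_⟩
      simp only [Tree.best, Finset.mem_filter, Finset.mem_univ, true_and]
      exact ⟨h2 b, fun c _ => hb c⟩
    · simp only [Tree.best, Finset.coe_filter, Finset.mem_univ, true_and] at ha
      by_contra hc
      exact absurd (ha.2 b (h2 b)) (not_le.2 (h1 b a (not_le.1 hc)))
  -- Almost sure eventual membership turns into convergence of probabilities through the convergence
  -- of indicators.
  have hlim : Tendsto (fun n => μ {ω | ω n ∈ G}) atTop (𝓝 1) := by
    have h := tendsto_measure_of_ae_tendsto_indicator (μ := μ) atTop (A := Set.univ)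
      (As := fun n => {ω | ω n ∈ G}) MeasurableSet.univ (fun n => (hlaw n G).1)
      (B := Set.univ) MeasurableSet.univ (measure_ne_top _ _)
      (Eventually.of_forall fun _ => Set.subset_univ _)
      (hG.mono fun ω h => by filter_upwards [h] with n hn; simpa using hn)
    simpa using h
  refine tendsto_of_tendsto_of_tendsto_of_le_of_le hlim tendsto_const_nhds (fun n => ?_)
    fun n => ?_
  · change μ {ω | ω n ∈ G} ≤ _
    rw [(hlaw n G).2, chainLaw_search, uctAction, PMF.toOuterMeasure_bind_apply,
      PMF.toOuterMeasure_apply]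
    refine ENNReal.tsum_le_tsum fun T => ?_
    by_cases hT : T ∈ G
    · rw [Set.indicator_of_mem hT, (PMF.toOuterMeasure_apply_eq_one_iff _ _).2, mul_one]
      exact fun a ha => hT.2 (θ.pick_mem _ hT.1 a ha)
    · rw [Set.indicator_of_notMem hT]
      exact zero_le
  · rw [← (PMF.toOuterMeasure_apply_eq_one_iff (uctAction M θ (k + 1) n x) Set.univ).2
      (Set.subset_univ _)]
    exact measure_mono (Set.subset_univ _)

end Consistency

end GUMDP

namespace GUMDP

/-! ### Calculus of finite expectations -/

section Expect

variable {Z Y : Type*}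

theorem expect_eq_sum_of_subset {p : PMF Z} {F : Finset Z} (hF : p.support ⊆ F) (g : Z → ℝ) :
    expect p g = ∑ z ∈ F, (p z).toReal * g z := by
  refine tsum_eq_sum fun z hz => ?_
  have : p z = 0 := by
    by_contra h
    exact hz (hF ((PMF.mem_support_iff _ _).2 h))
  simp [this]

theorem expect_eq_sum_univ [Fintype Z] (p : PMF Z) (g : Z → ℝ) :
    expect p g = ∑ z, (p z).toReal * g z :=
  expect_eq_sum_of_subset (by simp) g

theorem expect_pure (z : Z) (g : Z → ℝ) : expect (PMF.pure z) g = g z := by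
  rw [expect_eq_sum_of_subset (F := {z}) (by simp)]
  simp

theorem finite_support_bind {p : PMF Z} (hp : p.support.Finite) {q : Z → PMF Y}
    (hq : ∀ z, (q z).support.Finite) : (p.bind q).support.Finite := by
  rw [PMF.support_bind]
  exact hp.biUnion fun z _ => hq z

theorem expect_bind {p : PMF Z} (hp : p.support.Finite) {q : Z → PMF Y}
    (hq : ∀ z, (q z).support.Finite) (g : Y → ℝ) :
    expect (p.bind q) g = expect p fun z => expect (q z) g := by
  set F := (finite_support_bind hp hq).toFinset with hF
  have hsub : ∀ z ∈ p.support, (q z).support ⊆ F := by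
    intro z hz y hy
    rw [hF, Set.Finite.coe_toFinset, PMF.support_bind]
    exact Set.mem_biUnion hz hy
  rw [expect_eq_sum (finite_support_bind hp hq), expect_eq_sum hp]
  have h1 : ∀ z ∈ hp.toFinset, (p z).toReal * expect (q z) g
      = ∑ y ∈ F, (p z).toReal * ((q z y).toReal * g y) := fun z hz => by
    rw [expect_eq_sum_of_subset (hsub z (hp.mem_toFinset.1 hz)), Finset.mul_sum]
  rw [Finset.sum_congr rfl h1, Finset.sum_comm]
  refine Finset.sum_congr rfl fun y _ => ?_
  rw [PMF.bind_apply, tsum_eq_sum (s := hp.toFinset), ENNReal.toReal_sum, Finset.sum_mul]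
  · exact Finset.sum_congr rfl fun z _ => by rw [ENNReal.toReal_mul, mul_assoc]
  · exact fun z _ => ENNReal.mul_ne_top (p.apply_ne_top z) ((q z).apply_ne_top y)
  · intro z hz
    rw [Set.Finite.mem_toFinset, PMF.mem_support_iff, not_not] at hz
    simp [hz]

theorem finite_support_map {p : PMF Z} (hp : p.support.Finite) (φ : Z → Y) :
    (p.map φ).support.Finite := by
  rw [PMF.support_map]
  exact hp.image φ

theorem expect_map {p : PMF Z} (hp : p.support.Finite) (φ : Z → Y) (g : Y → ℝ) :
    expect (p.map φ) g = expect p fun z => g (φ z) := by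
  rw [← PMF.bind_pure_comp, expect_bind hp fun z => by simp [PMF.support_pure]]
  simp only [Function.comp_apply, expect_pure]

theorem expect_congr {p : PMF Z} {g g' : Z → ℝ} (h : ∀ z ∈ p.support, g z = g' z) :
    expect p g = expect p g' := by
  refine tsum_congr fun z => ?_
  by_cases hz : z ∈ p.support
  · rw [h z hz]
  · rw [PMF.mem_support_iff, not_not] at hz
    simp [hz]

theorem expect_mono {p : PMF Z} (hp : p.support.Finite) {g g' : Z → ℝ}
    (h : ∀ z ∈ p.support, g z ≤ g' z) : expect p g ≤ expect p g' := by
  rw [expect_eq_sum hp, expect_eq_sum hp]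
  exact Finset.sum_le_sum fun z hz =>
    mul_le_mul_of_nonneg_left (h z (hp.mem_toFinset.1 hz)) ENNReal.toReal_nonneg

theorem expect_const {p : PMF Z} (hp : p.support.Finite) (c : ℝ) : expect p (fun _ => c) = c := by
  rw [expect_eq_sum hp, ← Finset.sum_mul, sum_toReal_eq_one hp, one_mul]

theorem expect_const_add {p : PMF Z} (hp : p.support.Finite) (c : ℝ) (g : Z → ℝ) :
    expect p (fun z => c + g z) = c + expect p g := by
  nth_rewrite 2 [← expect_const hp c]
  simp only [expect_eq_sum hp, mul_add, Finset.sum_add_distrib]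

theorem expect_neg {p : PMF Z} (hp : p.support.Finite) (g : Z → ℝ) :
    expect p (fun z => -g z) = -expect p g := by
  simp only [expect_eq_sum hp, mul_neg, Finset.sum_neg_distrib]

theorem expect_sum {p : PMF Z} (hp : p.support.Finite) {ι : Type*} (s : Finset ι)
    (g : ι → Z → ℝ) : expect p (fun z => ∑ i ∈ s, g i z) = ∑ i ∈ s, expect p (g i) := by
  simp only [expect_eq_sum hp, Finset.mul_sum]
  exact Finset.sum_comm

theorem expect_affine {p : PMF Z} (hp : p.support.Finite) (c d : ℝ) (g : Z → ℝ) :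
    expect p (fun z => (g z - c) / d) = (expect p g - c) / d := by
  nth_rewrite 2 [← expect_const hp c]
  simp only [expect_eq_sum hp, ← Finset.sum_sub_distrib, Finset.sum_div]
  exact Finset.sum_congr rfl fun z _ => by ring

theorem tendsto_expect {p : PMF Z} (hp : p.support.Finite) {g : ℕ → Z → ℝ} {g' : Z → ℝ}
    (h : ∀ z ∈ p.support, Tendsto (fun n => g n z) atTop (𝓝 (g' z))) :
    Tendsto (fun n => expect p (g n)) atTop (𝓝 (expect p g')) := by
  simp only [expect_eq_sum hp]
  exact tendsto_finsetSum _ fun z hz => (h z (hp.mem_toFinset.1 hz)).const_mul _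

/-- If the laws concentrate on the minimizers of the limit, the expectations converge to the
minimum. -/
theorem tendsto_expect_iInf {A : Type*} [Fintype A] [Nonempty A] {p : ℕ → PMF A} {q : A → ℝ}
    {g : ℕ → A → ℝ} (hg : ∀ a, Tendsto (fun n => g n a) atTop (𝓝 (q a)))
    (hp : Tendsto (fun n => (p n).toOuterMeasure {a | ∀ b, q a ≤ q b}) atTop (𝓝 1)) :
    Tendsto (fun n => expect (p n) (g n)) atTop (𝓝 (⨅ a, q a)) := by
  classical
  obtain ⟨b, hb⟩ := exists_eq_ciInf_of_finite (f := q)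
  have hmin : ∀ a, q b ≤ q a := fun a => hb.trans_le (ciInf_le (Set.finite_range q).bddBelow a)
  have hle : ∀ n a, (p n a).toReal ≤ 1 := fun n a =>
    ENNReal.toReal_le_of_le_ofReal zero_le_one (by simpa using (p n).coe_le_one a)
  have hterm : ∀ a, Tendsto (fun n => (p n a).toReal * (g n a - q b)) atTop (𝓝 0) := by
    intro a
    have hga := (hg a).sub_const (q b)
    rcases (hmin a).lt_or_eq with hlt | heq
    · have hz : Tendsto (fun n => (p n a).toReal) atTop (𝓝 0) := by
        -- A suboptimal action only has the mass left over by the minimizers.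
        have h1 : ∀ n, p n a ≤ 1 - (p n).toOuterMeasure {a | ∀ b, q a ≤ q b} := by
          intro n
          have ha : a ∉ {a | ∀ b, q a ≤ q b} := fun h => absurd (h b) (not_le.2 hlt)
          have hdisj : (p n).toOuterMeasure {a | ∀ b, q a ≤ q b} + p n a ≤ 1 := by
            rw [PMF.toOuterMeasure_apply_fintype, ← (p n).tsum_coe, tsum_fintype,
              ← Finset.sum_erase_add _ _ (Finset.mem_univ a),
              ← Finset.sum_erase_add _ (fun x => p n x) (Finset.mem_univ a),
              Set.indicator_of_notMem ha, add_zero]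
            gcongr with c
            exact Set.indicator_le_self _ _ _
          exact ENNReal.le_sub_of_add_le_left (ne_top_of_le_ne_top ENNReal.one_ne_top
            (le_self_add.trans hdisj)) hdisj
        have h2 : Tendsto (fun n => 1 - (p n).toOuterMeasure {a | ∀ b, q a ≤ q b}) atTop (𝓝 0) := by
          simpa using ENNReal.Tendsto.sub tendsto_const_nhds hp (Or.inl ENNReal.one_ne_top)
        have h3 := tendsto_of_tendsto_of_tendsto_of_le_of_le tendsto_const_nhds h2
          (fun n => zero_le) h1
        simpa [Function.comp_def] using (ENNReal.tendsto_toReal ENNReal.zero_ne_top).comp h3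
      simpa using hz.mul hga
    · rw [← heq, sub_self] at hga
      exact bdd_le_mul_tendsto_zero' 1 (Eventually.of_forall fun n => by
        rw [abs_of_nonneg ENNReal.toReal_nonneg]; exact hle n a) hga
  have hsum := (tendsto_finsetSum Finset.univ fun a _ => hterm a).add_const (q b)
  simp only [Finset.sum_const_zero, zero_add] at hsum
  rw [← hb]
  refine hsum.congr fun n => ?_
  have h1 : ∑ a, (p n a).toReal = 1 := by
    have := expect_const (p := p n) (Set.toFinite _) 1
    simpa [expect_eq_sum_univ] using this
  simp only [mul_sub, Finset.sum_sub_distrib, ← Finset.sum_mul, h1, expect_eq_sum_univ]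
  ring

end Expect

/-! ### Dynamic programming -/

namespace MDP

variable {X A : Type*} [Fintype A] {M : MDP X A}

omit [Fintype A] in
-- `lawFrom` appends steps at the end, whereas Bellman's recursion needs the first step split off.
theorem lawFrom_succ' (π : X → PMF A) (x : X) (k : ℕ) :
    M.lawFrom π x (k + 1) = (π x).bind fun a => (M.step x a).bind fun y => M.lawFrom π y k := by
  induction k with
  | zero => simp [lawFrom, PMF.pure_bind, PMF.bind_pure]
  | succ k ih =>
    rw [lawFrom, ih]
    simp only [PMF.bind_bind]
    rfl

omit [Fintype A] in
theorem value_zero (π : X → PMF A) (x : X) : M.value π 0 x = M.cost x := by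
  simp [value, lawFrom, expect_pure]

variable (hfin : ∀ x a, (M.step x a).support.Finite)
include hfin

theorem finite_support_lawFrom (π : X → PMF A) (x : X) (k : ℕ) :
    (M.lawFrom π x k).support.Finite := by
  induction k with
  | zero => simp [lawFrom, PMF.support_pure]
  | succ k ih =>
    exact finite_support_bind ih fun y => finite_support_bind (Set.toFinite _) fun a => hfin y a

theorem value_succ (π : X → PMF A) (k : ℕ) (x : X) :
    M.value π (k + 1) x = expect (π x) (M.qValue π k x) := by
  have h1 : ∀ j, expect (M.lawFrom π x (j + 1)) M.cost = expect (π x) fun a =>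
      expect (M.step x a) fun y => expect (M.lawFrom π y j) M.cost := by
    intro j
    rw [lawFrom_succ', expect_bind (Set.toFinite _) fun a =>
      finite_support_bind (hfin x a) fun y => finite_support_lawFrom hfin π y j]
    refine expect_congr fun a _ => ?_
    rw [expect_bind (hfin x a) fun y => finite_support_lawFrom hfin π y j]
  rw [value, Finset.sum_range_succ']
  simp only [h1, show M.lawFrom π x 0 = PMF.pure x from rfl, expect_pure]
  rw [← expect_sum (Set.toFinite _), add_comm, ← expect_const_add (Set.toFinite _)]
  refine expect_congr fun a _ => ?_
  rw [← expect_sum (hfin x a)]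
  rfl

theorem dpV_le_value (π : X → PMF A) (k : ℕ) (x : X) : M.dpV k x ≤ M.value π k x := by
  induction k generalizing x with
  | zero => rw [value_zero]; rfl
  | succ k ih =>
    rw [value_succ hfin, ← expect_const (p := π x) (Set.toFinite _) (M.dpV (k + 1) x)]
    refine expect_mono (Set.toFinite _) fun a _ => ?_
    refine (ciInf_le (Set.finite_range _).bddBelow a).trans ?_
    exact add_le_add_right (expect_mono (hfin x a) fun y _ => ih y) _

/-- Layers of states by the number of steps to go, which is a function `c` of the state. -/
structure IsLayered (M : MDP X A) (c : X → ℕ) (layer : ℕ → X → Prop) : Prop where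
  eq : ∀ {k x}, layer k x → c x = k
  step : ∀ {k x a y}, layer (k + 1) x → y ∈ (M.step x a).support → layer k y

variable [Nonempty A] {c : X → ℕ} {layer : ℕ → X → Prop} (hl : IsLayered M c layer)
include hl

/-- On layered states some stationary deterministic policy attains the values of dynamic
programming. -/
theorem exists_value_eq_dpV :
    ∃ δ : X → A, ∀ k x, layer k x → M.value (fun y => PMF.pure (δ y)) k x = M.dpV k x := by
  -- Because c reads the steps to go from the state, a single stationary rule can be greedy at every
  -- time.
  have hδ : ∀ x, ∃ a, ∀ b, M.dpQ (c x - 1) x a ≤ M.dpQ (c x - 1) x b := fun x =>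
    Finite.exists_min _
  choose δ hδ using hδ
  refine ⟨δ, fun k => ?_⟩
  induction k with
  | zero => intro x _; rw [value_zero]; rfl
  | succ k ih =>
    intro x hx
    have hc : c x - 1 = k := by rw [hl.eq hx]; rfl
    rw [value_succ hfin, expect_pure]
    have h1 : M.qValue (fun y => PMF.pure (δ y)) k x (δ x) = M.dpQ k x (δ x) := by
      rw [qValue, dpQ, expect_congr fun y hy => ih y (hl.step hx hy)]
    rw [h1]
    refine le_antisymm (le_ciInf fun b => ?_) (ciInf_le (Set.finite_range _).bddBelow (δ x))
    have := hδ x b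
    rwa [hc] at this

/-- Dynamic programming bounds every policy from below, and the greedy stationary policy attains
this bound on all layers. -/
theorem optQ_eq_dpQ {k : ℕ} {x : X} (hx : layer (k + 1) x) (a : A) :
    M.optQ k x a = M.dpQ k x a := by
  have hle : ∀ δ : X → A, M.dpQ k x a ≤ M.qValue (fun y => PMF.pure (δ y)) k x a := fun δ =>
    add_le_add_right (expect_mono (hfin x a) fun y _ => dpV_le_value hfin _ k y) _
  obtain ⟨δ, hδ⟩ := exists_value_eq_dpV hfin hl
  refine le_antisymm ((ciInf_le ⟨_, by rintro _ ⟨δ, rfl⟩; exact hle δ⟩ δ).trans_eq ?_)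
    (le_ciInf hle)
  rw [qValue, dpQ, expect_congr fun y hy => hδ k y (hl.step hx hy)]

theorem optJ_eq_expect_dpV (hi : M.init.support.Finite)
    (h_layer : ∀ x ∈ M.init.support, layer M.horizon x) :
    M.optJ = expect M.init (M.dpV M.horizon) := by
  have hle : ∀ δ : X → A, expect M.init (M.dpV M.horizon) ≤ M.J fun y => PMF.pure (δ y) := fun δ =>
    expect_mono hi fun x _ => dpV_le_value hfin _ _ x
  obtain ⟨δ, hδ⟩ := exists_value_eq_dpV hfin hl
  refine le_antisymm ((ciInf_le ⟨_, by rintro _ ⟨δ, rfl⟩; exact hle δ⟩ δ).trans_eq ?_)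
    (le_ciInf hle)
  exact expect_congr fun x hx => hδ _ x (h_layer x hx)

omit hl in
-- By induction on the steps to go, the action values under π n converge to `dpQ`. Since π n x
-- concentrates on the minimizers, averaging them tends to the minimum.
theorem tendsto_value {π : ℕ → X → PMF A}
    (hstep : ∀ {k x a y}, layer (k + 1) x → y ∈ (M.step x a).support → layer k y)
    (hπ : ∀ k x, layer (k + 1) x → Tendsto (fun n => (π n x).toOuterMeasure
      {a | ∀ b, M.dpQ k x a ≤ M.dpQ k x b}) atTop (𝓝 1)) (k : ℕ) {x : X} (hx : layer k x) :
    Tendsto (fun n => M.value (π n) k x) atTop (𝓝 (M.dpV k x)) := by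
  induction k generalizing x with
  | zero => simp only [value_zero]; exact tendsto_const_nhds
  | succ k ih =>
    simp only [value_succ hfin]
    exact tendsto_expect_iInf (fun a => (tendsto_expect (hfin x a) fun y hy =>
      ih (hstep hx hy)).const_add _) (hπ k x hx)

theorem tendsto_J {π : ℕ → X → PMF A} (hi : M.init.support.Finite)
    (h_layer : ∀ x ∈ M.init.support, layer M.horizon x)
    (hπ : ∀ k x, layer (k + 1) x → Tendsto (fun n => (π n x).toOuterMeasure
      {a | ∀ b, M.dpQ k x a ≤ M.dpQ k x b}) atTop (𝓝 1)) :
    Tendsto (fun n => M.J (π n)) atTop (𝓝 M.optJ) := by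
  rw [optJ_eq_expect_dpV hfin hl hi h_layer]
  exact tendsto_expect hi fun x hx => tendsto_value hfin hl.step hπ _ (h_layer x hx)

end MDP

/-! ### The occupancy MDP -/

section Occupancy

variable {S A : Type*} [Fintype S] [Fintype A]

theorem clock_eq {γ : ℝ} (hγ : 0 < γ) {o : S × A → ℝ} {t : ℕ}
    (ho : ∑ z, o z = ∑ i ∈ Finset.range t, γ ^ i) : clock γ o = t := by
  -- As γ > 0, the partial geometric sums are distinct, so the sum of the entries determines the
  -- time.
  have hmono : StrictMono fun t : ℕ => ∑ i ∈ Finset.range t, γ ^ i :=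
    strictMono_nat_of_lt_succ fun t => by
      rw [Finset.sum_range_succ]
      exact lt_add_of_pos_right _ (pow_pos hγ t)
  have : {t : ℕ | ∑ z, o z = ∑ i ∈ Finset.range t, γ ^ i} = {t} := by
    ext u
    rw [Set.mem_ofPred_eq, Set.mem_singleton_iff, ho]
    exact ⟨fun h => (hmono.injective h).symm, fun h => by rw [h]⟩
  rw [clock, this, csInf_singleton]

theorem sum_nextOcc (γ : ℝ) (x : OState S A) (a : A) :
    ∑ z, nextOcc γ x a z = ∑ z, x.2 z + γ ^ clock γ x.2 := by
  classical
  have : ∀ z, nextOcc γ x a z = x.2 z + if z = (x.1, a) then γ ^ clock γ x.2 else 0 := by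
    intro z
    simp only [nextOcc]
    split_ifs <;> simp
  simp [this, Finset.sum_add_distrib]

theorem sum_runOcc (γ : ℝ) {l : ℕ} (h : Fin l → S × A) :
    ∑ z, runOcc γ h z = ∑ i ∈ Finset.range l, γ ^ i := by
  classical
  simp only [runOcc]
  rw [Finset.sum_comm, Finset.sum_range]
  simp

/-- States of the occupancy MDP with `k` steps to go until time `H`. -/
def OccLayer (γ : ℝ) (H k : ℕ) (x : OState S A) : Prop :=
  k ≤ H ∧ ∑ z, x.2 z = ∑ i ∈ Finset.range (H - k), γ ^ i

variable (E : Env S A) {γ : ℝ} (f : (S × A → ℝ) → ℝ) (H : ℕ)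

theorem occMDP_finite_step (x : OState S A) (a : A) :
    ((occMDP E γ f H).step x a).support.Finite :=
  finite_support_map (Set.toFinite _) _

theorem occMDP_finite_init : (occMDP E γ f H).init.support.Finite :=
  finite_support_map (Set.toFinite _) _

theorem occMDP_isLayered (hγ : 0 < γ) :
    MDP.IsLayered (occMDP E γ f H) (fun x => H - clock γ x.2) (OccLayer γ H) where
  eq {k x} hx := by
    have := hx.1
    rw [clock_eq hγ hx.2]
    omega
  step {k x a y} hx hy := by
    obtain ⟨s, -, rfl⟩ := (PMF.mem_support_map_iff _ _ _).1 hy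
    have hk := hx.1
    refine ⟨by omega, ?_⟩
    rw [sum_nextOcc, clock_eq hγ hx.2, hx.2, show H - k = H - (k + 1) + 1 by omega,
      Finset.sum_range_succ]

theorem occMDP_init_layer :
    ∀ x ∈ (occMDP E γ f H).init.support, OccLayer γ H (occMDP E γ f H).horizon x := by
  intro x hx
  obtain ⟨s, -, rfl⟩ := (PMF.mem_support_map_iff _ _ _).1 hx
  exact ⟨le_rfl, by simp [occMDP]⟩

theorem occMDP_cost_zero (hγ : 0 < γ) {x : OState S A} (hx : OccLayer γ H 0 x) :
    (occMDP E γ f H).cost x = f (((1 - γ) / (1 - γ ^ H)) • x.2) :=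
  if_pos (clock_eq hγ hx.2)

theorem occMDP_cost_succ (hγ : 0 < γ) {k : ℕ} {x : OState S A} (hx : OccLayer γ H (k + 1) x) :
    (occMDP E γ f H).cost x = 0 := by
  have := hx.1
  refine if_neg ?_
  rw [clock_eq hγ hx.2]
  omega

/-- An increasing affine map commutes with expectations and minima. The shift by `fmin` enters
exactly once, because all costs before the terminal layer vanish. -/
theorem dpV_rescale [Nonempty A] (hγ : 0 < γ) {fmin fmax : ℝ} (hlt : fmin < fmax) {k : ℕ}
    {x : OState S A} (hx : OccLayer γ H k x) :
    (occMDP E γ (rescale f fmin fmax) H).dpV k x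
      = ((occMDP E γ f H).dpV k x - fmin) / (fmax - fmin) := by
  induction k generalizing x with
  | zero =>
    rw [MDP.dpV, MDP.dpV, occMDP_cost_zero E _ H hγ hx, occMDP_cost_zero E _ H hγ hx]
    rfl
  | succ k ih =>
    have hmono : Monotone fun v : ℝ => (v - fmin) / (fmax - fmin) := fun u v huv =>
      div_le_div_of_nonneg_right (sub_le_sub_right huv _) (sub_pos.2 hlt).le
    rw [MDP.dpV, MDP.dpV]
    rw [hmono.map_ciInf_of_continuousAt (by fun_prop) (Set.finite_range _).bddBelow]
    congr 1
    funext a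
    rw [occMDP_cost_succ E _ H hγ hx, occMDP_cost_succ E _ H hγ hx, zero_add, zero_add,
      ← expect_affine (occMDP_finite_step E f H x a)]
    exact expect_congr fun y hy => ih ((occMDP_isLayered E _ H hγ).step hx hy)

/-- The search uses the rescaled objective while optimality is measured with f; this identifies the
two orderings of actions. -/
theorem dpQ_rescale_le_iff [Nonempty A] (hγ : 0 < γ) {fmin fmax : ℝ} (hlt : fmin < fmax) {k : ℕ}
    {x : OState S A} (hx : OccLayer γ H (k + 1) x) (a b : A) :
    (occMDP E γ (rescale f fmin fmax) H).dpQ k x a ≤ (occMDP E γ (rescale f fmin fmax) H).dpQ k x b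
      ↔ (occMDP E γ f H).dpQ k x a ≤ (occMDP E γ f H).dpQ k x b := by
  have h : ∀ a, (occMDP E γ (rescale f fmin fmax) H).dpQ k x a
      = ((occMDP E γ f H).dpQ k x a - fmin) / (fmax - fmin) := by
    intro a
    rw [MDP.dpQ, MDP.dpQ, occMDP_cost_succ E _ H hγ hx, occMDP_cost_succ E _ H hγ hx, zero_add,
      zero_add, ← expect_affine (occMDP_finite_step E f H x a)]
    exact expect_congr fun y hy =>
      dpV_rescale E f H hγ hlt ((occMDP_isLayered E _ H hγ).step hx hy)
  rw [h, h, div_le_div_iff_of_pos_right (sub_pos.2 hlt), sub_le_sub_iff_right]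

/-- The search concentrates on the optimal actions. -/
theorem tendsto_mctsOcc [Nonempty A] (hγ : 0 < γ) (θ : UCTParams (OState S A) A) {k : ℕ}
    {x : OState S A} (hx : OccLayer γ H (k + 1) x) :
    Tendsto (fun n => (mctsOcc E γ f H θ n x).toOuterMeasure
      {a | ∀ b, (occMDP E γ f H).dpQ k x a ≤ (occMDP E γ f H).dpQ k x b}) atTop (𝓝 1) := by
  have h : H - clock γ x.2 = k + 1 := (occMDP_isLayered E f H hγ).eq hx
  simp only [mctsOcc, h]
  exact tendsto_uctAction (occMDP_finite_step E f H) k x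

theorem tendsto_mctsOcc_rescale [Nonempty A] (hγ : 0 < γ) {fmin fmax : ℝ} (hlt : fmin < fmax)
    (θ : UCTParams (OState S A) A) {k : ℕ} {x : OState S A} (hx : OccLayer γ H (k + 1) x) :
    Tendsto (fun n => (mctsOcc E γ (rescale f fmin fmax) H θ n x).toOuterMeasure
      {a | ∀ b, (occMDP E γ f H).dpQ k x a ≤ (occMDP E γ f H).dpQ k x b}) atTop (𝓝 1) := by
  have := tendsto_mctsOcc E (rescale f fmin fmax) H hγ θ hx
  simpa only [dpQ_rescale_le_iff E f H hγ hlt hx] using this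

theorem optActions_eq [Nonempty A] (hγ : 0 < γ) {k : ℕ} {x : OState S A}
    (hx : OccLayer γ H (k + 1) x) : optActions E γ f H x
      = {a | ∀ b, (occMDP E γ f H).dpQ k x a ≤ (occMDP E γ f H).dpQ k x b} := by
  have h : H - clock γ x.2 - 1 = k := by
    rw [show H - clock γ x.2 = k + 1 from (occMDP_isLayered E f H hγ).eq hx]; rfl
  simp only [optActions, h,
    MDP.optQ_eq_dpQ (occMDP_finite_step E f H) (occMDP_isLayered E f H hγ) hx]

end Occupancy

end GUMDP

namespace GUMDP

/-! ### Trajectories and truncated occupancies -/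

section Truncation

/-- The first `n` pairs of a trajectory. -/
def trajPrefix {Y : Type*} (n : ℕ) (ω : ℕ → Y) : Fin n → Y := fun i => ω i

theorem trajPrefix_succ {Y : Type*} (n : ℕ) (ω : ℕ → Y) :
    trajPrefix (n + 1) ω = Fin.snoc (α := fun _ => Y) (trajPrefix n ω) (ω n) := by
  funext i
  refine Fin.lastCases ?_ (fun j => ?_) i
  · simp [trajPrefix]
  · simp [trajPrefix]

variable {S A : Type*} [Fintype S] [Fintype A]

theorem nextOcc_runOcc {γ : ℝ} (hγ : 0 < γ) {t : ℕ} (h : Fin t → S × A) (s : S) (a : A) :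
    nextOcc γ (s, runOcc γ h) a = runOcc γ (Fin.snoc (α := fun _ => S × A) h (s, a)) := by
  classical
  funext z
  rw [nextOcc, clock_eq hγ (sum_runOcc γ h)]
  simp only [runOcc, Fin.sum_univ_castSucc, Fin.snoc_castSucc, Fin.snoc_last, Fin.val_castSucc,
    Fin.val_last]
  by_cases hz : z = (s, a)
  · subst hz; simp
  · simp [hz, Ne.symm hz]

theorem occLayer_runOcc (γ : ℝ) {H t : ℕ} (ht : t ≤ H) (h : Fin t → S × A) (s : S) :
    OccLayer γ H (H - t) (s, runOcc γ h) :=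
  ⟨Nat.sub_le _ _, by rw [sum_runOcc, Nat.sub_sub_self ht]⟩

omit [Fintype S] [Fintype A] in
theorem runOcc_elim0 (γ : ℝ) : runOcc γ (Fin.elim0 : Fin 0 → S × A) = fun _ => 0 := by
  funext z; simp [runOcc]

theorem qValue_occMDP (E : Env S A) {γ : ℝ} (hγ : 0 < γ) (f : (S × A → ℝ) → ℝ) {H t : ℕ}
    (ht : t < H) (h : Fin t → S × A) (s : S) (a : A) (V : OState S A → ℝ) :
    (occMDP E γ f H).cost (s, runOcc γ h) + expect ((occMDP E γ f H).step (s, runOcc γ h) a) V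
      = expect (E.P a s) fun s' =>
        V (s', runOcc γ (Fin.snoc (α := fun _ => S × A) h (s, a))) := by
  have hl := occLayer_runOcc γ ht.le h s
  rw [show H - t = H - (t + 1) + 1 by omega] at hl
  rw [occMDP_cost_succ E f H hγ hl, zero_add]
  refine (expect_map (Set.toFinite _) _ _).trans ?_
  simp only [nextOcc_runOcc hγ]

/-! ### Error of truncating the discounted occupancy at the horizon -/

section Occupancy

variable {γ : ℝ} (hγ0 : 0 < γ) (hγ1 : γ < 1)
include hγ0 hγ1

open scoped Classical in
omit [Fintype S] [Fintype A] in
theorem summable_occ (ω : ℕ → S × A) (z : S × A) (m : ℕ) :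
    Summable fun t : ℕ => γ ^ (t + m) * (if ω (t + m) = z then (1 : ℝ) else 0) := by
  refine Summable.of_nonneg_of_le (fun t => by positivity) (fun t => ?_)
    ((summable_nat_add_iff m).2 (summable_geometric_of_lt_one hγ0.le hγ1))
  split_ifs <;> simp [pow_nonneg hγ0.le]

open scoped Classical in
theorem sum_tsum_occ (ω : ℕ → S × A) (m : ℕ) :
    ∑ z, ∑' t : ℕ, γ ^ (t + m) * (if ω (t + m) = z then (1 : ℝ) else 0) = γ ^ m / (1 - γ) := by
  rw [← Summable.tsum_finsetSum fun z _ => summable_occ hγ0 hγ1 ω z m]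
  simp only [← Finset.mul_sum, Finset.sum_ite_eq, Finset.mem_univ, if_true, mul_one, pow_add]
  rw [tsum_mul_right, tsum_geometric_of_lt_one hγ0.le hγ1, div_eq_mul_inv, mul_comm]

theorem empOcc_mem (ω : ℕ → S × A) : empOcc γ ω ∈ stdSimplex ℝ (S × A) := by
  classical
  refine ⟨fun z => mul_nonneg (sub_nonneg.2 hγ1.le) (tsum_nonneg fun t => by positivity), ?_⟩
  simp only [empOcc]
  rw [← Finset.mul_sum]
  have := sum_tsum_occ hγ0 hγ1 ω 0
  simp only [add_zero, pow_zero] at this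
  convert congrArg (fun u => (1 - γ) * u) this using 1
  exact (mul_div_cancel₀ _ (sub_pos.2 hγ1).ne').symm

theorem scaled_runOcc_mem {H : ℕ} (hH : 0 < H) (h : Fin H → S × A) :
    ((1 - γ) / (1 - γ ^ H)) • runOcc γ h ∈ stdSimplex ℝ (S × A) := by
  have h1 : 0 < 1 - γ := sub_pos.2 hγ1
  have h2 : 0 < 1 - γ ^ H := sub_pos.2 (pow_lt_one₀ hγ0.le hγ1 hH.ne')
  refine ⟨fun z => ?_, ?_⟩
  · have : 0 ≤ runOcc γ h z := Finset.sum_nonneg fun t _ => by positivity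
    rw [Pi.smul_apply, smul_eq_mul]
    positivity
  · simp only [Pi.smul_apply, smul_eq_mul]
    rw [← Finset.mul_sum, sum_runOcc, geom_sum_eq hγ1.ne, ← neg_sub 1 γ, ← neg_sub 1 (γ ^ H)]
    field_simp

/-- Distance between the occupancy of a trajectory and that of its truncation. -/
theorem sum_abs_empOcc_sub_le {H : ℕ} (hH : 0 < H) (ω : ℕ → S × A) :
    ∑ z, |empOcc γ ω z - (((1 - γ) / (1 - γ ^ H)) • runOcc γ (trajPrefix H ω)) z|
      ≤ 2 * γ ^ H := by
  classical
  have h1 : 0 < 1 - γ := sub_pos.2 hγ1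
  have h2 : 0 < 1 - γ ^ H := sub_pos.2 (pow_lt_one₀ hγ0.le hγ1 hH.ne')
  set R : S × A → ℝ := fun z => ∑' t : ℕ, γ ^ (t + H) * (if ω (t + H) = z then (1 : ℝ) else 0)
    with hR
  have hRsum : ∑ z, R z = γ ^ H / (1 - γ) := by
    rw [← sum_tsum_occ hγ0 hγ1 ω H]
  have hR0 : ∀ z, 0 ≤ R z := fun z => tsum_nonneg fun t => by positivity
  have ho0 : ∀ z, 0 ≤ runOcc γ (trajPrefix H ω) z := fun z =>
    Finset.sum_nonneg fun t _ => by positivity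
  have hsplit : ∀ z, empOcc γ ω z = (1 - γ) * (runOcc γ (trajPrefix H ω) z + R z) := by
    intro z
    have hs : Summable fun t : ℕ => γ ^ t * (if ω t = z then (1 : ℝ) else 0) := by
      simpa using summable_occ hγ0 hγ1 ω z 0
    have := hs.sum_add_tsum_nat_add H
    have ho : runOcc γ (trajPrefix H ω) z
        = ∑ t ∈ Finset.range H, γ ^ t * (if ω t = z then (1 : ℝ) else 0) := by
      rw [Finset.sum_range]
      refine Finset.sum_congr rfl fun t _ => ?_
      by_cases h : ω t = z <;> simp [trajPrefix, h]
    rw [ho, this, empOcc]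
  -- d is the excess of the renormalized factor over 1 − γ. The discarded tail has total mass γ^H,
  -- and so does the excess spread over the truncated occupancy; together they give 2γ^H.
  set d := (1 - γ) * γ ^ H / (1 - γ ^ H) with hd
  have hd0 : 0 ≤ d := by positivity
  have hc : (1 - γ) / (1 - γ ^ H) = (1 - γ) + d := by
    rw [hd]; field_simp; ring
  have hterm : ∀ z, |empOcc γ ω z - (((1 - γ) / (1 - γ ^ H)) • runOcc γ (trajPrefix H ω)) z|
      ≤ (1 - γ) * R z + d * runOcc γ (trajPrefix H ω) z := by
    intro z
    rw [hsplit, Pi.smul_apply, smul_eq_mul, hc, abs_le]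
    have := mul_nonneg h1.le (hR0 z)
    have := mul_nonneg hd0 (ho0 z)
    constructor <;> nlinarith
  refine (Finset.sum_le_sum fun z _ => hterm z).trans (le_of_eq ?_)
  rw [Finset.sum_add_distrib, ← Finset.mul_sum, ← Finset.mul_sum, hRsum, sum_runOcc,
    geom_sum_eq hγ1.ne, ← neg_sub 1 γ, ← neg_sub 1 (γ ^ H), hd]
  field_simp
  ring

variable {f : (S × A → ℝ) → ℝ} {L : ℝ} (hL : 0 ≤ L)
  (hLip : ∀ d₁ ∈ stdSimplex ℝ (S × A), ∀ d₂ ∈ stdSimplex ℝ (S × A),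
    |f d₁ - f d₂| ≤ L * ∑ z, |d₁ z - d₂ z|)
include hL hLip

theorem abs_empOcc_sub_le {H : ℕ} (hH : 0 < H) (ω : ℕ → S × A) :
    |f (empOcc γ ω) - f (((1 - γ) / (1 - γ ^ H)) • runOcc γ (trajPrefix H ω))|
      ≤ L * (2 * γ ^ H) :=
  (hLip _ (empOcc_mem hγ0 hγ1 ω) _ (scaled_runOcc_mem hγ0 hγ1 hH _)).trans
    (mul_le_mul_of_nonneg_left (sum_abs_empOcc_sub_le hγ0 hγ1 hH ω) hL)

end Occupancy

end Truncation

/-! ### Truncated trajectory costs and values of the occupancy MDP -/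

section Trajectory

variable {S A : Type*} [Fintype S] [Fintype A]
  [MeasurableSpace S] [DiscreteMeasurableSpace S] [MeasurableSpace A] [DiscreteMeasurableSpace A]

instance (E : Env S A) (π : Policy S A) : IsProbabilityMeasure (trajLaw E π) := by
  unfold trajLaw; infer_instance

theorem integral_toMeasure {Y : Type*} [Finite Y] [MeasurableSpace Y]
    [MeasurableSingletonClass Y] (p : PMF Y) (g : Y → ℝ) :
    ∫ y, g y ∂p.toMeasure = expect p g := by
  rw [PMF.integral_eq_tsum _ _ Integrable.of_finite]
  rfl

theorem measurable_comp_trajPrefix {Y Z : Type*} [Finite Y] [MeasurableSpace Y]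
    [MeasurableSingletonClass Y] [MeasurableSpace Z] (n : ℕ) (g : (Fin n → Y) → Z) :
    Measurable fun ω : ℕ → Y => g (trajPrefix n ω) :=
  (measurable_of_finite g).comp (measurable_pi_lambda _ fun _ => measurable_pi_apply _)

theorem integrable_comp_trajPrefix {Y : Type*} [Finite Y] [MeasurableSpace Y]
    [MeasurableSingletonClass Y] (μ : Measure (ℕ → Y)) [IsFiniteMeasure μ] (n : ℕ)
    (g : (Fin n → Y) → ℝ) : Integrable (fun ω => g (trajPrefix n ω)) μ := by
  obtain ⟨C, hC⟩ := (Set.finite_range fun h => ‖g h‖).bddAbove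
  exact Integrable.of_bound (measurable_comp_trajPrefix n g).aestronglyMeasurable C
    (Eventually.of_forall fun ω => hC ⟨_, rfl⟩)

theorem integral_trajPrefix_one (E : Env S A) (π : Policy S A) (g : (Fin 1 → S × A) → ℝ) :
    ∫ ω, g (trajPrefix 1 ω) ∂trajLaw E π = expect E.p₀ fun s => expect (π 0 Fin.elim0 s) fun a =>
      g (Fin.snoc (α := fun _ => S × A) Fin.elim0 (s, a)) := by
  have h := map_eval_zero_trajMeasure (X := fun _ => S × A)
    (E.p₀.bind fun s => (π 0 Fin.elim0 s).map fun a => (s, a)).toMeasure (nextKernel E π)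
  have h1 : ∀ ω : ℕ → S × A, trajPrefix 1 ω
      = Fin.snoc (α := fun _ => S × A) Fin.elim0 (ω 0) := fun ω => by
    rw [trajPrefix_succ]
    congr 1
    exact Subsingleton.elim _ _
  simp only [h1]
  rw [← integral_map (μ := trajLaw E π) (φ := fun ω => ω 0)
    (f := fun z => g (Fin.snoc (α := fun _ => S × A) Fin.elim0 z))
    (measurable_pi_apply 0).aemeasurable (measurable_of_finite _).aestronglyMeasurable, trajLaw, h,
    integral_toMeasure, expect_bind (Set.toFinite _) fun _ => Set.toFinite _]
  simp only [expect_map (Set.toFinite _)]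

theorem integral_trajPrefix_succ (E : Env S A) (π : Policy S A) (n : ℕ)
    (g : (Fin (n + 2) → S × A) → ℝ) :
    ∫ ω, g (trajPrefix (n + 2) ω) ∂trajLaw E π = ∫ ω, expect (E.P (ω n).2 (ω n).1) (fun s =>
      expect (π (n + 1) (trajPrefix (n + 1) ω) s) fun a =>
        g (Fin.snoc (α := fun _ => S × A) (trajPrefix (n + 1) ω) (s, a))) ∂trajLaw E π := by
  have h := Kernel.map_frestrictLe_trajMeasure_compProd_eq_map_trajMeasure (X := fun _ => S × A)
    (μ₀ := (E.p₀.bind fun s => (π 0 Fin.elim0 s).map fun a => (s, a)).toMeasure)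
    (κ := nextKernel E π) (a := n)
  set past : ((i : Finset.Iic n) → (fun _ : ℕ => S × A) i) → Fin (n + 1) → S × A :=
    fun w i => w ⟨i, Finset.mem_Iic.2 (Nat.lt_succ_iff.1 i.2)⟩ with hpast
  set G : ((i : Finset.Iic n) → (fun _ : ℕ => S × A) i) × (S × A) → ℝ :=
    fun q => g (Fin.snoc (α := fun _ => S × A) (past q.1) q.2) with hG
  have h1 : ∫ ω, g (trajPrefix (n + 2) ω) ∂trajLaw E π
      = ∫ q, G q ∂((trajLaw E π).map fun ω => (Preorder.frestrictLe n ω, ω (n + 1))) := by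
    rw [integral_map (by fun_prop) (measurable_of_finite _).aestronglyMeasurable]
    refine integral_congr_ae (Eventually.of_forall fun ω => ?_)
    exact congrArg g (trajPrefix_succ (n + 1) ω)
  rw [h1, trajLaw, ← h, Measure.integral_compProd Integrable.of_finite,
    integral_map (by fun_prop) (measurable_of_finite _).aestronglyMeasurable]
  refine integral_congr_ae (Eventually.of_forall fun ω => ?_)
  have hk : nextKernel E π n (Preorder.frestrictLe n ω)
      = ((E.P (ω n).2 (ω n).1).bind fun s =>
        (π (n + 1) (trajPrefix (n + 1) ω) s).map fun a => (s, a)).toMeasure := rfl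
  simp only [hk]
  rw [integral_toMeasure, expect_bind (Set.toFinite _) fun _ => Set.toFinite _]
  simp only [expect_map (Set.toFinite _)]
  rfl

/-- A function of the history that does not decrease in expectation along the trajectory. -/
theorem expect_le_integral_trajPrefix (E : Env S A) (π : Policy S A) {H : ℕ} (hH : 0 < H)
    (U : (t : ℕ) → (Fin t → S × A) → S → ℝ)
    (hU : ∀ t < H, ∀ h s, U t h s ≤ expect (π t h s) fun a =>
      expect (E.P a s) (U (t + 1) (Fin.snoc (α := fun _ => S × A) h (s, a))))
    (g : (Fin H → S × A) → ℝ) (hg : ∀ h s, U H h s = g h) :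
    expect E.p₀ (U 0 Fin.elim0) ≤ ∫ ω, g (trajPrefix H ω) ∂trajLaw E π := by
  -- The history ends with the pair at time n, so the state at time n + 1 is integrated explicitly
  -- against the transition law.
  have key : ∀ n < H, expect E.p₀ (U 0 Fin.elim0)
      ≤ ∫ ω, expect (E.P (ω n).2 (ω n).1) (U (n + 1) (trajPrefix (n + 1) ω)) ∂trajLaw E π := by
    intro n
    induction n with
    | zero =>
      intro h0
      have := integral_trajPrefix_one E π fun h =>
        expect (E.P (h (Fin.last 0)).2 (h (Fin.last 0)).1) (U 1 h)
      refine le_trans ?_ this.ge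
      refine expect_mono (Set.toFinite _) fun s _ => ?_
      simpa only [Fin.snoc_last] using hU 0 h0 Fin.elim0 s
    | succ n ih =>
      intro hn
      refine (ih (by omega)).trans ?_
      have := integral_trajPrefix_succ E π n fun h =>
        expect (E.P (h (Fin.last (n + 1))).2 (h (Fin.last (n + 1))).1) (U (n + 2) h)
      refine le_trans ?_ this.ge
      simp only [Fin.snoc_last]
      refine integral_mono
        (integrable_comp_trajPrefix _ (n + 1) fun h =>
          expect (E.P (h (Fin.last n)).2 (h (Fin.last n)).1) (U (n + 1) h))
        (integrable_comp_trajPrefix _ (n + 1) fun h =>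
          expect (E.P (h (Fin.last n)).2 (h (Fin.last n)).1) fun s => expect (π (n + 1) h s) fun a =>
            expect (E.P a s) (U (n + 2) (Fin.snoc (α := fun _ => S × A) h (s, a)))) fun ω => ?_
      exact expect_mono (Set.toFinite _) fun s _ => hU (n + 1) hn _ s
  obtain ⟨n, rfl⟩ := Nat.exists_eq_add_one.2 hH
  refine (key n (by omega)).trans_eq (integral_congr_ae (Eventually.of_forall fun ω => ?_))
  -- At time H the value no longer depends on the current state, so its expectation drops out.
  exact (expect_congr fun s _ => hg _ s).trans (expect_const (Set.toFinite _) _)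

/-- Expected cost of a trajectory truncated at time `H`. -/
noncomputable def truncF (E : Env S A) (γ : ℝ) (f : (S × A → ℝ) → ℝ) (H : ℕ) (π : Policy S A) : ℝ :=
  ∫ ω, f (((1 - γ) / (1 - γ ^ H)) • runOcc γ (trajPrefix H ω)) ∂trajLaw E π

/-- Along any history-dependent policy, `dpV` at the current state and running occupancy does not
decrease in expectation, since a minimum over actions is below any average. At time H it is the
truncated cost. -/
theorem truncF_ge_optJ [Nonempty A] (E : Env S A) {γ : ℝ} (hγ : 0 < γ) (f : (S × A → ℝ) → ℝ)
    {H : ℕ} (hH : 0 < H) (π : Policy S A) : (occMDP E γ f H).optJ ≤ truncF E γ f H π := by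
  rw [MDP.optJ_eq_expect_dpV (occMDP_finite_step E f H) (occMDP_isLayered E f H hγ)
    (occMDP_finite_init E f H) (occMDP_init_layer E f H)]
  refine le_trans (le_of_eq ?_) (expect_le_integral_trajPrefix E π hH
    (fun t h s => (occMDP E γ f H).dpV (H - t) (s, runOcc γ h)) (fun t ht h s => ?_)
    (fun h => f (((1 - γ) / (1 - γ ^ H)) • runOcc γ h)) fun h s => ?_)
  · refine (expect_map (Set.toFinite _) _ _).trans ?_
    simp only [runOcc_elim0]
    rfl
  · rw [show H - t = H - (t + 1) + 1 by omega,
      ← expect_const (p := π t h s) (Set.toFinite _) ((occMDP E γ f H).dpV _ _)]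
    refine expect_mono (Set.toFinite _) fun a _ => ?_
    refine (ciInf_le (Set.finite_range _).bddBelow a).trans_eq ?_
    exact qValue_occMDP E hγ f ht h s a _
  · have hl := occLayer_runOcc γ le_rfl h s
    rw [Nat.sub_self] at hl ⊢
    exact occMDP_cost_zero E f H hγ hl

/-- Before H the policy follows `πO`, so its value is preserved in expectation. Feeding the negated
value to `expect_le_integral_trajPrefix` gives the one inequality needed, and `tail` plays no role.
-/
theorem truncF_toPolicy_le (E : Env S A) {γ : ℝ} (hγ : 0 < γ) (f : (S × A → ℝ) → ℝ)
    {H : ℕ} (hH : 0 < H) (πO : OState S A → PMF A) (tail : Policy S A) :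
    truncF E γ f H (toPolicy γ H πO tail) ≤ (occMDP E γ f H).J πO := by
  have := expect_le_integral_trajPrefix E (toPolicy γ H πO tail) hH
    (fun t h s => -(occMDP E γ f H).value πO (H - t) (s, runOcc γ h)) (fun t ht h s => ?_)
    (fun h => -f (((1 - γ) / (1 - γ ^ H)) • runOcc γ h)) fun h s => ?_
  · rw [integral_neg, expect_neg (Set.toFinite _), neg_le_neg_iff] at this
    refine this.trans_eq (Eq.symm ?_)
    refine (expect_map (Set.toFinite _) _ _).trans ?_
    simp only [runOcc_elim0]
    rfl
  · simp only [expect_neg (Set.toFinite _), neg_le_neg_iff]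
    rw [show H - t = H - (t + 1) + 1 by omega, MDP.value_succ (occMDP_finite_step E f H), toPolicy,
      if_pos ht]
    refine le_of_eq (expect_congr fun a _ => ?_)
    exact (qValue_occMDP E hγ f ht h s a _).symm
  · have hl := occLayer_runOcc γ le_rfl h s
    rw [Nat.sub_self] at hl ⊢
    rw [MDP.value_zero, occMDP_cost_zero E f H hγ hl]

/-! ### From the truncated to the full objective -/

section Occupancy

variable {γ : ℝ} (hγ0 : 0 < γ) (hγ1 : γ < 1)
include hγ0 hγ1

variable {f : (S × A → ℝ) → ℝ} {L : ℝ} (hL : 0 ≤ L)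
  (hLip : ∀ d₁ ∈ stdSimplex ℝ (S × A), ∀ d₂ ∈ stdSimplex ℝ (S × A),
    |f d₁ - f d₂| ≤ L * ∑ z, |d₁ z - d₂ z|)
include hL hLip

/-- Since f is controlled only on the simplex, measurability is obtained from the truncations: they
depend on finitely many coordinates with finitely many values, and they converge pointwise. -/
theorem measurable_empOcc : Measurable fun ω : ℕ → S × A => f (empOcc γ ω) := by
  refine measurable_of_tendsto_metrizable (fun n => measurable_comp_trajPrefix (n + 1)
    fun h => f (((1 - γ) / (1 - γ ^ (n + 1))) • runOcc γ h)) (tendsto_pi_nhds.2 fun ω => ?_)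
  rw [tendsto_iff_dist_tendsto_zero]
  have hlim : Tendsto (fun n : ℕ => L * (2 * γ ^ (n + 1))) atTop (𝓝 0) := by
    have := ((tendsto_pow_atTop_nhds_zero_of_lt_one hγ0.le hγ1).comp
      (tendsto_add_atTop_nat 1)).const_mul 2 |>.const_mul L
    simpa using this
  refine squeeze_zero (fun _ => dist_nonneg) (fun n => ?_) hlim
  rw [dist_comm, Real.dist_eq]
  exact abs_empOcc_sub_le hγ0 hγ1 hL hLip n.succ_pos ω

variable {fmin fmax : ℝ} (hf : ∀ d ∈ stdSimplex ℝ (S × A), fmin ≤ f d ∧ f d ≤ fmax)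
include hf

theorem abs_F₁_sub_truncF_le (E : Env S A) {H : ℕ} (hH : 0 < H) (π : Policy S A) :
    |F₁ E γ f π - truncF E γ f H π| ≤ L * (2 * γ ^ H) := by
  have hint : Integrable (fun ω => f (empOcc γ ω)) (trajLaw E π) :=
    Integrable.of_bound (measurable_empOcc hγ0 hγ1 hL hLip).aestronglyMeasurable
      (max |fmin| |fmax|) (Eventually.of_forall fun ω =>
        abs_le_max_abs_abs (hf _ (empOcc_mem hγ0 hγ1 ω)).1 (hf _ (empOcc_mem hγ0 hγ1 ω)).2)
  rw [F₁, truncF, ← integral_sub hint (integrable_comp_trajPrefix _ H fun h =>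
    f (((1 - γ) / (1 - γ ^ H)) • runOcc γ h))]
  have := norm_integral_le_of_norm_le_const (μ := trajLaw E π)
    (f := fun ω => f (empOcc γ ω) - f (((1 - γ) / (1 - γ ^ H)) • runOcc γ (trajPrefix H ω)))
    (Eventually.of_forall fun ω => abs_empOcc_sub_le hγ0 hγ1 hL hLip hH ω)
  simpa using this

/-- The regret of a policy that follows a policy of the occupancy MDP until time `H`. -/
theorem regret_toPolicy_le [Nonempty A] (E : Env S A) {H : ℕ} (hH : 0 < H)
    (πO : OState S A → PMF A) (tail : Policy S A) :
    regret E γ f (toPolicy γ H πO tail)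
      ≤ 4 * L * γ ^ H + ((occMDP E γ f H).J πO - (occMDP E γ f H).optJ) := by
  have hbd := fun π => abs_le.1 (abs_F₁_sub_truncF_le hγ0 hγ1 hL hLip hf E hH π)
  have : Nonempty (Policy S A) := ⟨tail⟩
  -- One truncation error 2Lγ^H is paid here for the infimum and a second one for the policy itself.
  have hinf : (occMDP E γ f H).optJ - L * (2 * γ ^ H) ≤ ⨅ π, F₁ E γ f π :=
    le_ciInf fun π => by linarith [(hbd π).1, truncF_ge_optJ E hγ0 f hH π]
  have h1 := (hbd (toPolicy γ H πO tail)).2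
  have h2 := truncF_toPolicy_le E hγ0 f hH πO tail
  rw [regret]
  linarith

end Occupancy

end Trajectory

end GUMDP

/-! ### Consistency and regret of the tree search -/

theorem mainTheorem6 {S A : Type*} [Fintype S] [Fintype A]
    [MeasurableSpace S] [DiscreteMeasurableSpace S] [MeasurableSpace A] [DiscreteMeasurableSpace A]
    (E : GUMDP.Env S A) (γ : ℝ) (hγ0 : 0 < γ) (hγ1 : γ < 1)
    (f : (S × A → ℝ) → ℝ) (L : ℝ) (hL : 0 < L)
    (hLip : ∀ d₁ ∈ stdSimplex ℝ (S × A), ∀ d₂ ∈ stdSimplex ℝ (S × A),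
      |f d₁ - f d₂| ≤ L * ∑ z, |d₁ z - d₂ z|)
    (fmin fmax : ℝ) (hlt : fmin < fmax)
    (hf : ∀ d ∈ stdSimplex ℝ (S × A), fmin ≤ f d ∧ f d ≤ fmax)
    (H : ℕ) (hH : 0 < H) (θ : GUMDP.UCTParams (GUMDP.OState S A) A) :
    -- the returned action is optimal with probability tending to one, at every state
    (∀ s : S, ∀ o ∈ GUMDP.occSet S A γ H,
      Tendsto (fun n : ℕ =>
        (GUMDP.mctsOcc E γ (GUMDP.rescale f fmin fmax) H θ n (s, o)).toOuterMeasure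
          (GUMDP.optActions E γ f H (s, o))) atTop (𝓝 1)) ∧
    -- the cumulative cost in the occupancy MDP tends to the optimal one
    Tendsto (fun n : ℕ => (GUMDP.occMDP E γ f H).J
        (GUMDP.mctsOcc E γ (GUMDP.rescale f fmin fmax) H θ n)) atTop
      (𝓝 (GUMDP.occMDP E γ f H).optJ) ∧
    -- regret bounds, for the rescaled and for the original objective
    (∀ᶠ n : ℕ in atTop, ∀ tail : GUMDP.Policy S A,
      GUMDP.regret E γ (GUMDP.rescale f fmin fmax)
          (GUMDP.toPolicy γ H (GUMDP.mctsOcc E γ (GUMDP.rescale f fmin fmax) H θ n) tail)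
        ≤ 8 * (L / (fmax - fmin)) * γ ^ H ∧
      GUMDP.regret E γ f
          (GUMDP.toPolicy γ H (GUMDP.mctsOcc E γ (GUMDP.rescale f fmin fmax) H θ n) tail)
        ≤ 8 * L * γ ^ H) := by
  -- Even on the empty set `pick` is a probability law on A, so A is nonempty.
  obtain ⟨a₀, -⟩ := (θ.pick ∅).support_nonempty
  have : Nonempty A := ⟨a₀⟩
  have hΔ : 0 < fmax - fmin := sub_pos.2 hlt
  -- The same search policy is evaluated under two objectives g: f itself and its rescaling.
  have hJ : ∀ g : (S × A → ℝ) → ℝ, (∀ k x, GUMDP.OccLayer γ H (k + 1) x → Tendsto (fun n =>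
      (GUMDP.mctsOcc E γ (GUMDP.rescale f fmin fmax) H θ n x).toOuterMeasure
        {a | ∀ b, (GUMDP.occMDP E γ g H).dpQ k x a ≤ (GUMDP.occMDP E γ g H).dpQ k x b}) atTop
          (𝓝 1)) → Tendsto (fun n : ℕ => (GUMDP.occMDP E γ g H).J
        (GUMDP.mctsOcc E γ (GUMDP.rescale f fmin fmax) H θ n)) atTop
      (𝓝 (GUMDP.occMDP E γ g H).optJ) := fun g hg =>
    GUMDP.MDP.tendsto_J (GUMDP.occMDP_finite_step E g H) (GUMDP.occMDP_isLayered E g H hγ0)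
      (GUMDP.occMDP_finite_init E g H) (GUMDP.occMDP_init_layer E g H) hg
  have hJf := hJ f fun k x hx => GUMDP.tendsto_mctsOcc_rescale E f H hγ0 hlt θ hx
  have hJr := hJ (GUMDP.rescale f fmin fmax) fun k x hx =>
    GUMDP.tendsto_mctsOcc E _ H hγ0 θ hx
  refine ⟨?_, hJf, ?_⟩
  · rintro s _ ⟨l, hl, h, rfl⟩
    have hx := GUMDP.occLayer_runOcc γ hl.le h s
    rw [show H - l = H - l - 1 + 1 by omega] at hx
    rw [GUMDP.optActions_eq E f H hγ0 hx]
    exact GUMDP.tendsto_mctsOcc_rescale E f H hγ0 hlt θ hx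
  · have hLr : ∀ d₁ ∈ stdSimplex ℝ (S × A), ∀ d₂ ∈ stdSimplex ℝ (S × A),
        |GUMDP.rescale f fmin fmax d₁ - GUMDP.rescale f fmin fmax d₂|
          ≤ L / (fmax - fmin) * ∑ z, |d₁ z - d₂ z| := by
      intro d₁ h₁ d₂ h₂
      rw [GUMDP.rescale, GUMDP.rescale, ← sub_div, sub_sub_sub_cancel_right, abs_div,
        abs_of_pos hΔ, div_mul_eq_mul_div]
      exact div_le_div_of_nonneg_right (hLip d₁ h₁ d₂ h₂) hΔ.le
    have hfr : ∀ d ∈ stdSimplex ℝ (S × A), 0 ≤ GUMDP.rescale f fmin fmax d ∧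
        GUMDP.rescale f fmin fmax d ≤ 1 := fun d hd =>
      ⟨div_nonneg (sub_nonneg.2 (hf d hd).1) hΔ.le,
        div_le_one_of_le₀ (sub_le_sub_right (hf d hd).2 _) hΔ.le⟩
    have hpow : 0 < γ ^ H := pow_pos hγ0 H
    have hLΔ : 0 < L / (fmax - fmin) := div_pos hL hΔ
    -- Half of the constant 8 pays for the truncations; the other half is a positive margin that the
    -- optimality gap of `J` eventually undercuts. This gap does not involve `tail`, so the
    -- threshold for n is uniform in it.
    filter_upwards [hJf.eventually (gt_mem_nhds (lt_add_of_pos_right _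
        (show 0 < 4 * L * γ ^ H by positivity))),
      hJr.eventually (gt_mem_nhds (lt_add_of_pos_right _
        (show 0 < 4 * (L / (fmax - fmin)) * γ ^ H by positivity)))] with n h1 h2 tail
    have h3 := GUMDP.regret_toPolicy_le hγ0 hγ1 hL.le hLip hf E hH
      (GUMDP.mctsOcc E γ (GUMDP.rescale f fmin fmax) H θ n) tail
    have h4 := GUMDP.regret_toPolicy_le hγ0 hγ1 hLΔ.le hLr hfr E hH
      (GUMDP.mctsOcc E γ (GUMDP.rescale f fmin fmax) H θ n) tail
    exact ⟨by linarith, by linarith⟩
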